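/- Let $\Lambda$ be a semigroup, and let $\Lambda^e$ be $\Lambda$ itself if it has an identity $e$, and $\Lambda$ with an identity $e$ added otherwise. Let $F\subset\Lambda$ be a finite generating subset (every element of $\Lambda\smallsetminus\{e\}$ is a nonempty product of elements of $F$; the empty product is $e$). For $x\in\Lambda^e$ let $|x|_F$ be the least number of factors in an expression of $x$ as a product of elements of $F$ (so $|e|_F=0$), and let $d_F$ be the undirected graph distance on $\Lambda^e$ for the graph with an edge between $x$ and $xf$ for all $x\in\Lambda^e$, $f\in F$. For $\kappa\in(0,1]$ and $\kappa'\ge 0$ let $$\mathcal{QG}_F^{\kappa,\kappa'}=\{(f_k)_{k\in\mathbb N}\in F^{\mathbb N} : |f_k\cdots f_{k+\ell}|_F\ge\kappa(\ell+1)-\kappa'\ \ \forall k,\ell\in\mathbb N\},$$ with the topology induced by the product topology of $F^{\mathbb N}$ ($F$ discrete), and let $\mathcal{QG}_F=\bigcup_{\kappa,\kappa'}\mathcal{QG}_F^{\kappa,\kappa'}$ with the inductive limit topology: a subset is open if and only if its intersection with every $\mathcal{QG}_F^{\kappa,\kappa'}$ is open. Write $(f_k)\sim(g_k)$ if there is $N$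 such that for every $n\ge1$ there are $m,m'\ge1$ with $d_F(f_0\cdots f_{n-1},g_0\cdots g_{m-1})\le N$ and $d_F(g_0\cdots g_{n-1},f_0\cdots f_{m'-1})\le N$. The quasigeodesic boundary is $\partial\Lambda=\mathcal{QG}_F/\!\sim$, with the quotient topology. For $g\in\mathrm{GL}(d,\mathbb R)$ let $\mu_1(g)\ge\dots\ge\mu_d(g)$ be the logarithms of its singular values, and when $\mu_i(g)>\mu_{i+1}(g)$ let $\Xi_i(g)\in\mathrm{Gr}_i(\mathbb R^d)$ be the sum of the eigenspaces of $gg^t$ for the eigenvalues $e^{2\mu_1(g)},\dots,e^{2\mu_i(g)}$. Let $1\le i<d$ be integers and let $\rho:\Lambda\to\mathrm{GL}(d,\mathbb R)$ be a $P_i$-Anosov semigroup homomorphism, i.e. there are $c,c'>0$ with $(\mu_i-\mu_{i+1})(\rho(\gamma))\ge c|\gamma|_F-c'$ for all $\gamma\in\Lambda$ (this does not depend on the choice of the finite generating set). Then: 1. For every $(f_k)\in\mathcal{QG}_F$, $\Xi_i(\rho(f_0\cdots f_{n-1}))$ is defined for all large $n$ and the limit $E^{cs}((f_k)_k)=\lim_{n\to\infty}\Xi_i(\rho(f_0\cdots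 f_{n-1}))\in\mathrm{Gr}_i(\mathbb R^d)$ exists; the map $E^{cs}:\mathcal{QG}_F\to\mathrm{Gr}_i(\mathbb R^d)$ is continuous. 2. There is a well-defined action of $\Lambda$ on $\partial\Lambda$: if $\gamma=w_0\cdots w_{n-1}$ with $w_j\in F$ and $(f_k)\in\mathcal{QG}_F$, then $(w_0,\dots,w_{n-1},f_0,f_1,\dots)\in\mathcal{QG}_F$, and $\gamma\cdot[(f_k)_k]$ is its class. The map $E^{cs}$ factors through a continuous map $\xi:\partial\Lambda\to\mathrm{Gr}_i(\mathbb R^d)$, which is $\rho$-equivariant: $\xi(\gamma\cdot\eta)=\rho(\gamma)\,\xi(\eta)$ for all $\gamma\in\Lambda$ and $\eta\in\partial\Lambda$. 3. The map $\xi$ is dynamics-preserving: for any $\gamma\in\Lambda$, if there exist $(f_k)\in\mathcal{QG}_F$, a strictly increasing function $\phi:\mathbb N^*\to\mathbb N^*$ and $N\ge0$ with $d_F(\gamma^n,f_0\cdots f_{\phi(n)-1})\le N$ for all $n\in\mathbb N^*$, then the image by $\xi$ of $\eta_\gamma^+:=[(f_k)_k]\in\partial\Lambda$ is an attracting fixed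 point of $\rho(\gamma)$ in $\mathrm{Gr}_i(\mathbb R^d)$, i.e. it is fixed by $\rho(\gamma)$ and has a neighborhood on which $\rho(\gamma)^n$ converges uniformly to it as $n\to+\infty$. -/

import Mathlib

open Filter Topology

noncomputable section

namespace AnosovSemigroup

/-! ### The monoid obtained by possibly adding an identity, and the Cayley graph -/

/-- `x` acts as a two-sided identity on all elements of `Λ`. -/
def IsNeutral {Λ : Type*} [Semigroup Λ] (x : WithOne Λ) : Prop :=
  ∀ a : Λ, x * (a : WithOne Λ) = a ∧ (a : WithOne Λ) * x = a

/-- The congruence on `WithOne Λ` that identifies the new identity with the identity of `Λ`,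
if there is one (and is equality otherwise). -/
def unitCon (Λ : Type*) [Semigroup Λ] : Con (WithOne Λ) where
  r x y := x = y ∨ (IsNeutral x ∧ IsNeutral y)
  iseqv :=
    { refl := fun x => Or.inl rfl
      symm := by
        rintro x y (h | ⟨h, h'⟩)
        · exact Or.inl h.symm
        · exact Or.inr ⟨h', h⟩
      trans := by
        rintro x y z (h | ⟨h, h'⟩) (k | ⟨k, k'⟩)
        · exact Or.inl (h.trans k)
        · exact Or.inr ⟨h ▸ k, k'⟩
        · exact Or.inr ⟨h, k ▸ h'⟩
        · exact Or.inr ⟨h, k'⟩ }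
  mul' := by
    have key : ∀ x y : WithOne Λ, IsNeutral x → IsNeutral y → IsNeutral (x * y) := by
      intro x y hx hy a
      refine ⟨?_, ?_⟩
      · rw [mul_assoc, (hy a).1, (hx a).1]
      · rw [← mul_assoc, (hx a).2, (hy a).2]
    rintro w x y z (rfl | ⟨h, h'⟩) (rfl | ⟨k, k'⟩)
    · exact Or.inl rfl
    · refine WithOne.cases_on w (Or.inr ?_) (fun a => Or.inl ?_)
      · simpa using ⟨k, k'⟩
      · rw [(k a).2, (k' a).2]
    · refine WithOne.cases_on y (Or.inr ?_) (fun a => Or.inl ?_)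
      · simpa using ⟨h, h'⟩
      · rw [(h a).1, (h' a).1]
    · exact Or.inr ⟨key _ _ h k, key _ _ h' k'⟩

/-- `Λ^e`: the semigroup `Λ` if it has an identity, and `Λ` with an identity added otherwise. -/
abbrev Unitization (Λ : Type*) [Semigroup Λ] : Type _ := (unitCon Λ).Quotient

/-- The inclusion of `Λ` in `Λ^e`. -/
def incl {Λ : Type*} [Semigroup Λ] (a : Λ) : Unitization Λ :=
  ((a : WithOne Λ) : (unitCon Λ).Quotient)

theorem incl_mul {Λ : Type*} [Semigroup Λ] (a b : Λ) : incl (a * b) = incl a * incl b := by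
  simp only [incl, WithOne.coe_mul, Con.coe_mul]

theorem incl_injective {Λ : Type*} [Semigroup Λ] :
    Function.Injective (incl : Λ → Unitization Λ) := by
  intro a b h
  rcases (Con.eq (unitCon Λ)).1 h with h | ⟨ha, hb⟩
  · exact WithOne.coe_injective h
  · have h1 := (ha b).1
    have h2 := (hb a).2
    exact WithOne.coe_injective (h2.symm.trans h1)

theorem incl_eq_one_iff {Λ : Type*} [Semigroup Λ] (u : Λ) :
    incl u = 1 ↔ ∀ a : Λ, u * a = a ∧ a * u = a := by
  constructor
  · intro h a
    constructor
    · apply incl_injective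
      rw [incl_mul, h, one_mul]
    · apply incl_injective
      rw [incl_mul, h, mul_one]
  · intro h
    refine (Con.eq (unitCon Λ)).2 (Or.inr ⟨fun a => ?_, fun a => ?_⟩)
    · rw [← WithOne.coe_mul, ← WithOne.coe_mul, (h a).1, (h a).2]
      exact ⟨rfl, rfl⟩
    · simp

/-- The value in `Λ^e` of a word in the letters `F`; the empty word has value `e`. -/
def wordVal {Λ : Type*} [Semigroup Λ] (F : Finset Λ) (w : List F) : Unitization Λ :=
  (w.map fun f => incl (f : Λ)).prod

/-- `F` generates `Λ`: every element of `Λ^e` is a product of elements of `F`, the identity `e`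
being allowed to be the empty product. -/
def Generates {Λ : Type*} [Semigroup Λ] (F : Finset Λ) : Prop :=
  ∀ x : Unitization Λ, ∃ w : List F, wordVal F w = x

/-- Word length on `Λ^e`. One has `|e|_F = 0` by the empty word, and only nonempty words represent
an element different from `e`. -/
def wordLength {Λ : Type*} [Semigroup Λ] (F : Finset Λ) (x : Unitization Λ) : ℕ :=
  sInf {n : ℕ | ∃ w : List F, w.length = n ∧ wordVal F w = x}

/-- The undirected graph underlying the Cayley graph: vertices `Λ^e`, edges between `x` and `x f`.
The distance `d_F` between vertices is `(cayleyGraph F).edist`. -/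
def cayleyGraph {Λ : Type*} [Semigroup Λ] (F : Finset Λ) : SimpleGraph (Unitization Λ) :=
  SimpleGraph.fromRel fun x y => ∃ f ∈ F, y = x * incl f

/-! ### Quasigeodesic sequences and the quasigeodesic boundary -/

/-- `seg f k l = f_k f_{k+1} ⋯ f_{k+l}`, a product of `l + 1` letters. -/
def seg {Λ : Type*} [Semigroup Λ] {F : Finset Λ} (f : ℕ → F) (k : ℕ) : ℕ → Λ
  | 0 => (f k : Λ)
  | l + 1 => seg f k l * (f (k + (l + 1)) : Λ)

/-- The condition defining `QG_F^{κ,κ'}`. -/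
def IsQG {Λ : Type*} [Semigroup Λ] {F : Finset Λ} (κ κ' : ℝ) (f : ℕ → F) : Prop :=
  ∀ k l : ℕ, κ * ((l : ℝ) + 1) - κ' ≤ (wordLength F (incl (seg f k l)) : ℝ)

/-- The space `QG_F^{κ,κ'}`. -/
def QGConst {Λ : Type*} [Semigroup Λ] (F : Finset Λ) (κ κ' : ℝ) : Type _ :=
  {f : ℕ → F // IsQG κ κ' f}

/-- `QG_F^{κ,κ'}` has the subspace topology of the product `F^ℕ` of discrete spaces. -/
instance instTopQGConst {Λ : Type*} [Semigroup Λ] (F : Finset Λ) (κ κ' : ℝ) :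
    TopologicalSpace (QGConst F κ κ') :=
  TopologicalSpace.induced Subtype.val (@Pi.topologicalSpace ℕ (fun _ => F) fun _ => ⊥)

/-- `QG_F`, the union of the `QG_F^{κ,κ'}` over `κ ∈ (0,1]` and `κ' ≥ 0`. -/
def QG {Λ : Type*} [Semigroup Λ] (F : Finset Λ) : Type _ :=
  {f : ℕ → F // ∃ κ κ' : ℝ, 0 < κ ∧ κ ≤ 1 ∧ 0 ≤ κ' ∧ IsQG κ κ' f}

/-- The inclusion of `QG_F^{κ,κ'}` in `QG_F`. -/
def QGConst.toQG {Λ : Type*} [Semigroup Λ] {F : Finset Λ} (κ : Set.Ioc (0 : ℝ) 1)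
    (κ' : Set.Ici (0 : ℝ)) (f : QGConst F κ κ') : QG F :=
  ⟨f.1, κ, κ', κ.2.1, κ.2.2, κ'.2, f.2⟩

/-- The union `QG_F` has the inductive limit topology: a set is open if and only if its trace on
each `QG_F^{κ,κ'}` is open. -/
instance instTopQG {Λ : Type*} [Semigroup Λ] (F : Finset Λ) : TopologicalSpace (QG F) :=
  ⨆ (κ : Set.Ioc (0 : ℝ) 1) (κ' : Set.Ici (0 : ℝ)),
    TopologicalSpace.coinduced (QGConst.toQG (F := F) κ κ') (instTopQGConst F κ κ')

/-- Every vertex of the path `(f_0 ⋯ f_n)_n` is at distance at most `N` from the path of `g`. -/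
def StaysWithin {Λ : Type*} [Semigroup Λ] {F : Finset Λ} (N : ℕ) (f g : ℕ → F) : Prop :=
  ∀ n : ℕ, ∃ m : ℕ, (cayleyGraph F).edist (incl (seg f 0 n)) (incl (seg g 0 m)) ≤ N

theorem StaysWithin.trans {Λ : Type*} [Semigroup Λ] {F : Finset Λ} {M N : ℕ} {f g h : ℕ → F}
    (h₁ : StaysWithin M f g) (h₂ : StaysWithin N g h) : StaysWithin (M + N) f h := by
  intro n
  obtain ⟨m, hm⟩ := h₁ n
  obtain ⟨l, hl⟩ := h₂ m
  refine ⟨l, (SimpleGraph.edist_triangle (v := incl (seg g 0 m))).trans ?_⟩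
  push_cast
  exact add_le_add hm hl

/-- Two elements of `QG_F` are equivalent if their paths remain at bounded distance. -/
def qgSetoid {Λ : Type*} [Semigroup Λ] (F : Finset Λ) : Setoid (QG F) where
  r f g := ∃ N : ℕ, StaysWithin N f.1 g.1 ∧ StaysWithin N g.1 f.1
  iseqv :=
    { refl := fun f => ⟨0, fun n => ⟨n, by simp⟩, fun n => ⟨n, by simp⟩⟩
      symm := fun ⟨N, h, h'⟩ => ⟨N, h', h⟩
      trans := fun ⟨M, h, h'⟩ ⟨N, k, k'⟩ =>
        ⟨M + N, h.trans k, by simpa only [Nat.add_comm] using k'.trans h'⟩ }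

/-- The quasigeodesic boundary `∂Λ = QG_F / ∼`. -/
def Boundary {Λ : Type*} [Semigroup Λ] (F : Finset Λ) : Type _ := Quotient (qgSetoid F)

/-- The boundary has the quotient topology. -/
instance instTopBoundary {Λ : Type*} [Semigroup Λ] (F : Finset Λ) :
    TopologicalSpace (Boundary F) :=
  TopologicalSpace.coinduced (Quotient.mk (qgSetoid F)) (instTopQG F)

/-- The class of an element of `QG_F` in the boundary. -/
def endpoint {Λ : Type*} [Semigroup Λ] {F : Finset Λ} (f : QG F) : Boundary F :=
  Quotient.mk (qgSetoid F) f

/-- The sequence `w_0, …, w_{n-1}, f_0, f_1, …` obtained by putting a word in front. -/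
def prepend {Λ : Type*} {F : Finset Λ} (w : List F) (f : ℕ → F) (a : ℕ) : F :=
  w.getD a (f (a - w.length))

/-- `act` is the natural action of `Λ` on `∂Λ`: to act by `γ` on `[f]`, put any word with value `γ`
in front of `f`; the new sequence is again in `QG_F`, and its class is `γ · [f]`. -/
structure IsNaturalAction {Λ : Type*} [Semigroup Λ] {F : Finset Λ}
    (act : Λ → Boundary F → Boundary F) : Prop where
  act_endpoint : ∀ (γ : Λ) (w : List F), wordVal F w = incl γ → ∀ f : QG F,
    ∃ g : QG F, g.1 = prepend w f.1 ∧ act γ (endpoint f) = endpoint g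
  mul_act : ∀ (γ γ' : Λ) (η : Boundary F), act (γ * γ') η = act γ (act γ' η)

/-! ### Singular values, Grassmannians, Anosov homomorphisms -/

/-- `μ_j(g)`, for `1 ≤ j ≤ d`: the logarithm of the `j`-th largest singular value of `g`. -/
def mu {d : ℕ} (j : ℕ) (g : GL (Fin d) ℝ) : ℝ :=
  Real.log ((Matrix.toEuclideanLin (g : Matrix (Fin d) (Fin d) ℝ)).singularValues (j - 1))

/-- `ρ` has a uniform `i`-gap in singular values with respect to `F`. -/
def HasUniformGap {Λ : Type*} [Semigroup Λ] (F : Finset Λ) {d : ℕ} (i : ℕ)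
    (ρ : Λ →ₙ* GL (Fin d) ℝ) : Prop :=
  ∃ c c' : ℝ, 0 < c ∧ 0 < c' ∧ ∀ γ : Λ,
    c * (wordLength F (incl γ) : ℝ) - c' ≤ mu i (ρ γ) - mu (i + 1) (ρ γ)

/-- `ρ` is `P_i`-Anosov: `Λ` is finitely generated and `ρ` has a uniform `i`-gap in singular values
(with respect to some finite generating subset, equivalently to all of them). -/
def IsAnosov {Λ : Type*} [Semigroup Λ] {d : ℕ} (i : ℕ) (ρ : Λ →ₙ* GL (Fin d) ℝ) : Prop :=
  ∃ F : Finset Λ, Generates F ∧ HasUniformGap F i ρ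

/-- The Grassmannian of `i`-planes of `ℝ^d`. -/
def Gr (d i : ℕ) : Type :=
  {V : Submodule ℝ (EuclideanSpace ℝ (Fin d)) // Module.finrank ℝ V = i}

/-- The usual topology of the Grassmannian, through the embedding that sends a subspace to the
orthogonal projection onto it. -/
instance instTopGr (d i : ℕ) : TopologicalSpace (Gr d i) :=
  TopologicalSpace.induced (fun V => V.1.starProjection) inferInstance

/-- An invertible matrix as a linear automorphism of `ℝ^d`. -/
def toEquiv {d : ℕ} (g : GL (Fin d) ℝ) :
    EuclideanSpace ℝ (Fin d) ≃ₗ[ℝ] EuclideanSpace ℝ (Fin d) :=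
  LinearEquiv.ofLinearMap (Matrix.toEuclideanLin (g : Matrix (Fin d) (Fin d) ℝ))
    (Matrix.toEuclideanLin ((g⁻¹ : GL (Fin d) ℝ) : Matrix (Fin d) (Fin d) ℝ))
    (by ext1 x; simp [Matrix.toLpLin_apply])
    (by ext1 x; simp [Matrix.toLpLin_apply])

/-- The action of `GL(d,ℝ)` on the Grassmannian. -/
def Gr.move {d i : ℕ} (g : GL (Fin d) ℝ) (V : Gr d i) : Gr d i :=
  ⟨V.1.map (toEquiv g).toLinearMap, ((toEquiv g).finrank_map_eq V.1).trans V.2⟩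

/-- `Ξ_j(g)`: the sum of the eigenspaces of `g gᵗ` for the eigenvalues
`e^{2 μ_1(g)}, …, e^{2 μ_j(g)}`. It has dimension `j` if `μ_j(g) > μ_{j+1}(g)`. -/
def Xi {d : ℕ} (j : ℕ) (g : GL (Fin d) ℝ) : Submodule ℝ (EuclideanSpace ℝ (Fin d)) :=
  ⨆ k ∈ Finset.Icc 1 j, Module.End.eigenspace
    (Matrix.toEuclideanLin ((g : Matrix (Fin d) (Fin d) ℝ) * (g : Matrix (Fin d) (Fin d) ℝ).transpose))
    (Real.exp (2 * mu k g))

/-- `Ξ_i(g_n)` is well defined for all large `n` and converges to `V` in the Grassmannian. -/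
def XiTendsto {d i : ℕ} (g : ℕ → GL (Fin d) ℝ) (V : Gr d i) : Prop :=
  (∀ᶠ n in atTop, mu (i + 1) (g n) < mu i (g n)) ∧
  ∃ W : ℕ → Gr d i, (∀ᶠ n in atTop, (W n).1 = Xi i (g n)) ∧ Tendsto W atTop (𝓝 V)

/-- `V` is an attracting fixed point of `g` in the Grassmannian: `g V = V`, and `V` has a
neighborhood `U` on which the iterates of `g` converge uniformly to `V`. -/
def IsAttractingFixedPoint {d i : ℕ} (g : GL (Fin d) ℝ) (V : Gr d i) : Prop :=
  Gr.move g V = V ∧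
  ∃ U ∈ 𝓝 V, ∀ O ∈ 𝓝 V, ∀ᶠ n : ℕ in atTop, ∀ W ∈ U, Gr.move (g ^ n) W ∈ O

end AnosovSemigroup

end

open AnosovSemigroup

noncomputable section

namespace AnosovSemigroup

section

open Module LinearMap

/-! ### Singular values of endomorphisms of a Euclidean space -/

section SingularValues

variable {E : Type*} [NormedAddCommGroup E] [InnerProductSpace ℝ E] [FiniteDimensional ℝ E]

/-! Everything is controlled by the ratio σ_{i+1}/σ_i of singular values (`gapRatio`) and the
condition number ‖h‖‖h⁻¹‖ (`cond`). Multiplying g by h on either side changes the ratio by a factor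
at most `cond h`. Moreover Ξ_i(gh) is within 4 · cond(h) · gapRatio(g) of Ξ_i(g), and Ξ_i(hg) is
equally close to h Ξ_i(g) (`grDist_xiGr_mul_right`, `grDist_xiGr_mul_left`).

Along a quasigeodesic the Anosov condition makes the ratio decay exponentially, so the planes Ξ_i
form a Cauchy sequence. The rate depends only on κ and κ', which gives continuity on each QG^{κ,κ'}
and hence on the inductive limit. A path of length N in the Cayley graph becomes, under ρ, right
multiplication by a matrix of bounded condition number: edges run backwards contribute inverses in
GL, although Λ has none. Hence equivalent sequences have the same limit, and the estimate for left
multiplication gives equivariance.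

The action needs an argument because left multiplication in a semigroup could collapse lengths. It
cannot do so here: the ratio of ρ(x) is at least exp(-L|x|), so a short product ax would bound the
gap of ρ(x), and therefore |x| (`GapBounds.le_wordLength_mul`).

If γ^n follows a quasigeodesic, the ratio of ρ(γ)^n decays exponentially. This forces a gap in the
moduli of the eigenvalues after the i-th one (`exists_isSplitting_finrank_eq`). The invariant
i-plane of the large eigenvalues attracts nearby planes and is also the limit of Ξ_i(ρ(γ)^n), hence
it is the value of ξ. -/

/-- An orthonormal basis of right singular vectors. -/
def rightBasis (T : E →ₗ[ℝ] E) : OrthonormalBasis (Fin (finrank ℝ E)) ℝ E :=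
  T.isSymmetric_adjoint_comp_self.eigenvectorBasis rfl

theorem adjoint_apply_rightBasis (T : E →ₗ[ℝ] E) (j : Fin (finrank ℝ E)) :
    adjoint T (T (rightBasis T j)) = (T.singularValues j ^ 2) • rightBasis T j := by
  have h := T.isSymmetric_adjoint_comp_self.apply_eigenvectorBasis rfl j
  rw [T.sq_singularValues_fin rfl j]
  exact h

theorem inner_rightBasis_adjoint (T : E →ₗ[ℝ] E) (j : Fin (finrank ℝ E)) (x : E) :
    inner ℝ (rightBasis T j) (adjoint T (T x)) =
      T.singularValues j ^ 2 * inner ℝ (rightBasis T j) x := by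
  rw [adjoint_inner_right, ← adjoint_inner_left, adjoint_apply_rightBasis, inner_smul_left]
  simp

theorem norm_sq_apply_eq_sum (T : E →ₗ[ℝ] E) (x : E) :
    ‖T x‖ ^ 2 = ∑ j : Fin (finrank ℝ E), T.singularValues j ^ 2 * inner ℝ (rightBasis T j) x ^ 2 := by
  rw [← real_inner_self_eq_norm_sq, ← adjoint_inner_right,
    ← (rightBasis T).sum_inner_mul_inner]
  refine Finset.sum_congr rfl fun j _ => ?_
  rw [inner_rightBasis_adjoint, real_inner_comm]
  ring

theorem norm_sq_eq_sum_rightBasis (T : E →ₗ[ℝ] E) (x : E) :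
    ‖x‖ ^ 2 = ∑ j, inner ℝ (rightBasis T j) x ^ 2 := by
  rw [← (rightBasis T).sum_sq_norm_inner_right x]
  simp

/-- The span of the right singular vectors with index in `S`. -/
def rightSpan (T : E →ₗ[ℝ] E) (S : Set ℕ) : Submodule ℝ E :=
  Submodule.span ℝ (rightBasis T '' {j | (j : ℕ) ∈ S})

theorem mem_rightSpan (T : E →ₗ[ℝ] E) (S : Set ℕ) (x : E) :
    x ∈ rightSpan T S ↔ ∀ j : Fin (finrank ℝ E), (j : ℕ) ∉ S → inner ℝ (rightBasis T j) x = 0 := by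
  rw [rightSpan, ← OrthonormalBasis.coe_toBasis, Module.Basis.mem_span_image]
  simp only [Set.subset_def, Finset.mem_coe, Finsupp.mem_support_iff, Set.mem_ofPred_eq]
  refine forall_congr' fun j => ?_
  rw [OrthonormalBasis.coe_toBasis_repr_apply, OrthonormalBasis.repr_apply_apply]
  tauto

theorem finrank_rightSpan_Iio (T : E →ₗ[ℝ] E) {k : ℕ} (hk : k ≤ finrank ℝ E) :
    finrank ℝ (rightSpan T (Set.Iio k)) = k := by
  classical
  have hinj : Function.Injective (rightBasis T) := (rightBasis T).toBasis.injective.comp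
    (fun _ _ h => h) |> fun h => by simpa using h
  have : LinearIndepOn ℝ id (rightBasis T '' {j | (j : ℕ) ∈ Set.Iio k}) :=
    ((rightBasis T).orthonormal.linearIndependent.linearIndepOn_id).mono (Set.image_subset_range _ _)
  rw [rightSpan, finrank_span_set_eq_card this, Set.toFinset_card, Set.card_image_of_injective _ hinj]
  simp only [Set.mem_Iio, Set.coe_ofPred, Fintype.card_subtype]
  have h := Fin.card_filter_val_lt (n := finrank ℝ E) (m := k)
  rwa [min_eq_right hk] at h

theorem rightSpan_Ici_eq_orthogonal (T : E →ₗ[ℝ] E) (k : ℕ) :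
    rightSpan T (Set.Ici k) = (rightSpan T (Set.Iio k))ᗮ := by
  ext x
  rw [mem_rightSpan, Submodule.mem_orthogonal]
  constructor
  · intro h u hu
    rw [← (rightBasis T).sum_inner_mul_inner]
    refine Finset.sum_eq_zero fun j _ => ?_
    by_cases hj : (j : ℕ) < k
    · rw [h j (by simpa using hj), mul_zero]
    · rw [real_inner_comm, (mem_rightSpan T _ u).1 hu j (by simpa using hj), zero_mul]
  · intro h j hj
    refine h _ (Submodule.subset_span ⟨j, ?_, rfl⟩)
    simpa using hj

theorem le_norm_apply_of_mem_rightSpan (T : E →ₗ[ℝ] E) {k : ℕ} {x : E}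
    (hx : x ∈ rightSpan T (Set.Iic k)) : T.singularValues k * ‖x‖ ≤ ‖T x‖ := by
  refine le_of_sq_le_sq (α := ℝ) ?_ (norm_nonneg _)
  rw [mul_pow, norm_sq_apply_eq_sum, norm_sq_eq_sum_rightBasis T, Finset.mul_sum]
  refine Finset.sum_le_sum fun j _ => ?_
  by_cases hj : (j : ℕ) ≤ k
  · have := T.singularValues_antitone hj
    have := T.singularValues_nonneg k
    gcongr
  · rw [(mem_rightSpan T _ x).1 hx j (by simpa using hj)]
    simp

theorem norm_apply_le_of_mem_rightSpan (T : E →ₗ[ℝ] E) {k : ℕ} {x : E}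
    (hx : x ∈ rightSpan T (Set.Ici k)) : ‖T x‖ ≤ T.singularValues k * ‖x‖ := by
  refine le_of_sq_le_sq (α := ℝ) ?_ (mul_nonneg (T.singularValues_nonneg k) (norm_nonneg _))
  rw [mul_pow, norm_sq_apply_eq_sum, norm_sq_eq_sum_rightBasis T, Finset.mul_sum]
  refine Finset.sum_le_sum fun j _ => ?_
  by_cases hj : k ≤ (j : ℕ)
  · have := T.singularValues_antitone hj
    have := T.singularValues_nonneg j
    gcongr
  · rw [(mem_rightSpan T _ x).1 hx j (by simpa using hj)]
    simp

theorem exists_ne_zero_mem_inf {X Y : Submodule ℝ E}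
    (h : finrank ℝ E < finrank ℝ X + finrank ℝ Y) : ∃ x, x ∈ X ∧ x ∈ Y ∧ x ≠ 0 := by
  have h1 := Submodule.finrank_sup_add_finrank_inf_eq X Y
  have h2 := Submodule.finrank_le (X ⊔ Y)
  have h3 : 0 < finrank ℝ (X ⊓ Y : Submodule ℝ E) := by omega
  have h4 : X ⊓ Y ≠ ⊥ := by
    rintro h
    rw [h, finrank_bot] at h3
    exact h3.false
  obtain ⟨x, hx, hx0⟩ := Submodule.exists_mem_ne_zero_of_ne_bot h4
  exact ⟨x, hx.1, hx.2, hx0⟩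

/-- Half of the Courant–Fischer principle: by dimension count, X meets the span of the right
singular vectors of index at least k, where T stretches by at most the k-th singular value. -/
theorem le_singularValues_of_forall_mem (T : E →ₗ[ℝ] E) {k : ℕ} {X : Submodule ℝ E}
    (hX : k < finrank ℝ X) {a : ℝ} (h : ∀ x ∈ X, a * ‖x‖ ≤ ‖T x‖) : a ≤ T.singularValues k := by
  have hd : k < finrank ℝ E := hX.trans_le (Submodule.finrank_le X)
  have h1 := finrank_rightSpan_Iio T hd.le
  have h2 := (rightSpan T (Set.Iio k)).finrank_add_finrank_orthogonal
  obtain ⟨x, hx, hx', hx0⟩ := exists_ne_zero_mem_inf (X := X) (Y := rightSpan T (Set.Ici k)) (by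
    rw [rightSpan_Ici_eq_orthogonal]; omega)
  have h3 := (h x hx).trans (norm_apply_le_of_mem_rightSpan T hx')
  exact le_of_mul_le_mul_right h3 (norm_pos_iff.2 hx0)

theorem singularValues_le_of_forall_mem (T : E →ₗ[ℝ] E) {k : ℕ} {Y : Submodule ℝ E}
    (hk : k < finrank ℝ E) (hY : finrank ℝ E ≤ finrank ℝ Y + k) {b : ℝ}
    (h : ∀ x ∈ Y, ‖T x‖ ≤ b * ‖x‖) : T.singularValues k ≤ b := by
  have h1 := finrank_rightSpan_Iio T (k := k + 1) hk
  obtain ⟨x, hx, hx', hx0⟩ := exists_ne_zero_mem_inf (X := rightSpan T (Set.Iio (k + 1))) (Y := Y) (by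
    omega)
  have h3 := (le_norm_apply_of_mem_rightSpan T (k := k) (x := x) (by
    have : Set.Iic k = Set.Iio (k + 1) := by ext; simp
    rwa [this])).trans (h x hx')
  exact le_of_mul_le_mul_right h3 (norm_pos_iff.2 hx0)

end SingularValues

/-! ### Matrices as operators -/

/-- The operator of `ℝ^d` given by an invertible matrix. -/
def op {d : ℕ} (g : GL (Fin d) ℝ) : EuclideanSpace ℝ (Fin d) →L[ℝ] EuclideanSpace ℝ (Fin d) :=
  Matrix.toEuclideanCLM (𝕜 := ℝ) (g : Matrix (Fin d) (Fin d) ℝ)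

variable {d : ℕ}

theorem op_mul (g h : GL (Fin d) ℝ) : op (g * h) = op g * op h := by
  simp [op]

@[simp]
theorem op_one : op (1 : GL (Fin d) ℝ) = 1 := by
  simp [op]

theorem op_mul_apply (g h : GL (Fin d) ℝ) (x) : op (g * h) x = op g (op h x) := by
  rw [op_mul]; rfl

@[simp]
theorem op_inv_apply_self (g : GL (Fin d) ℝ) (x) : op g⁻¹ (op g x) = x := by
  rw [← op_mul_apply]; simp

@[simp]
theorem op_apply_inv_self (g : GL (Fin d) ℝ) (x) : op g (op g⁻¹ x) = x := by
  rw [← op_mul_apply]; simp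

theorem coe_op (g : GL (Fin d) ℝ) :
    (op g : EuclideanSpace ℝ (Fin d) →ₗ[ℝ] EuclideanSpace ℝ (Fin d)) =
      Matrix.toEuclideanLin (g : Matrix (Fin d) (Fin d) ℝ) :=
  Matrix.coe_toEuclideanCLM_eq_toEuclideanLin _

theorem toEuclideanLin_apply_eq_op (g : GL (Fin d) ℝ) (x) :
    Matrix.toEuclideanLin (g : Matrix (Fin d) (Fin d) ℝ) x = op g x := by
  rw [← coe_op]; rfl

theorem toEquiv_apply (g : GL (Fin d) ℝ) (x) : toEquiv g x = op g x :=
  toEuclideanLin_apply_eq_op g x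

theorem norm_op_pos [NeZero d] (g : GL (Fin d) ℝ) : 0 < ‖op g‖ := by
  rw [norm_pos_iff]
  intro h
  have : (op g * op g⁻¹ : EuclideanSpace ℝ (Fin d) →L[ℝ] EuclideanSpace ℝ (Fin d)) = 0 := by
    rw [h, zero_mul]
  rw [← op_mul, mul_inv_cancel, op_one] at this
  exact one_ne_zero this

/-- The `k`-th singular value of `g`, numbered from `0`. -/
def sv (k : ℕ) (g : GL (Fin d) ℝ) : ℝ :=
  (Matrix.toEuclideanLin (g : Matrix (Fin d) (Fin d) ℝ)).singularValues k

theorem sv_pos {k : ℕ} (hk : k < d) (g : GL (Fin d) ℝ) : 0 < sv k g := by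
  refine (injective_iff_forall_lt_finrank_singularValues_pos _).1 ?_ k (by simpa using hk)
  exact (toEquiv g).injective

theorem le_sv (g : GL (Fin d) ℝ) {k : ℕ} {X : Submodule ℝ (EuclideanSpace ℝ (Fin d))}
    (hX : k < finrank ℝ X) {a : ℝ} (h : ∀ x ∈ X, a * ‖x‖ ≤ ‖op g x‖) : a ≤ sv k g :=
  le_singularValues_of_forall_mem _ hX fun x hx => by
    rw [toEuclideanLin_apply_eq_op]; exact h x hx

theorem sv_le (g : GL (Fin d) ℝ) {k : ℕ} (hk : k < d)
    {Y : Submodule ℝ (EuclideanSpace ℝ (Fin d))} (hY : d ≤ finrank ℝ Y + k) {b : ℝ}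
    (h : ∀ x ∈ Y, ‖op g x‖ ≤ b * ‖x‖) : sv k g ≤ b :=
  singularValues_le_of_forall_mem _ (by simpa using hk) (by simpa using hY) fun x hx => by
    rw [toEuclideanLin_apply_eq_op]; exact h x hx

theorem exists_slow (g : GL (Fin d) ℝ) {k : ℕ} (hk : k < d) :
    ∃ Y : Submodule ℝ (EuclideanSpace ℝ (Fin d)), d = finrank ℝ Y + k ∧
      ∀ x ∈ Y, ‖op g x‖ ≤ sv k g * ‖x‖ := by
  let T := Matrix.toEuclideanLin (g : Matrix (Fin d) (Fin d) ℝ)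
  refine ⟨rightSpan T (Set.Ici k), ?_, fun x hx => ?_⟩
  · have h1 := finrank_rightSpan_Iio T (k := k) (by simpa using hk.le)
    have h2 := (rightSpan T (Set.Iio k)).finrank_add_finrank_orthogonal
    rw [finrank_euclideanSpace_fin] at h2
    rw [rightSpan_Ici_eq_orthogonal]; omega
  · have := norm_apply_le_of_mem_rightSpan T hx
    rwa [toEuclideanLin_apply_eq_op] at this

theorem sv_mul_le_left (g h : GL (Fin d) ℝ) {k : ℕ} (hk : k < d) :
    sv k (h * g) ≤ ‖op h‖ * sv k g := by
  obtain ⟨Y, hY, hY'⟩ := exists_slow g hk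
  refine sv_le _ hk hY.le fun x hx => ?_
  rw [op_mul_apply, mul_assoc]
  exact ((op h).le_opNorm _).trans (mul_le_mul_of_nonneg_left (hY' x hx) (norm_nonneg _))

theorem sv_mul_le_right (g h : GL (Fin d) ℝ) {k : ℕ} (hk : k < d) :
    sv k (g * h) ≤ ‖op h‖ * sv k g := by
  obtain ⟨Y, hY, hY'⟩ := exists_slow g hk
  refine sv_le _ hk (Y := Y.map (toEquiv h⁻¹).toLinearMap) ?_ ?_
  · rw [LinearEquiv.finrank_map_eq]; exact hY.le
  · rintro _ ⟨y, hy, rfl⟩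
    have h1 : (toEquiv h⁻¹).toLinearMap y = op h⁻¹ y := toEquiv_apply _ _
    rw [h1, op_mul_apply, op_apply_inv_self]
    refine (hY' y hy).trans ?_
    have h2 := (op h).le_opNorm (op h⁻¹ y)
    rw [op_apply_inv_self] at h2
    calc sv k g * ‖y‖ ≤ sv k g * (‖op h‖ * ‖op h⁻¹ y‖) :=
          mul_le_mul_of_nonneg_left h2 (sv_pos hk g).le
      _ = _ := by ring

/-- The condition number of `h`. -/
def cond (h : GL (Fin d) ℝ) : ℝ := ‖op h‖ * ‖op h⁻¹‖

theorem cond_nonneg (h : GL (Fin d) ℝ) : 0 ≤ cond h := by unfold cond; positivity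

theorem cond_inv (h : GL (Fin d) ℝ) : cond h⁻¹ = cond h := by
  rw [cond, cond, inv_inv, mul_comm]

theorem cond_mul_le (g h : GL (Fin d) ℝ) : cond (g * h) ≤ cond g * cond h := by
  rw [cond, op_mul, mul_inv_rev, op_mul]
  calc _ ≤ (‖op g‖ * ‖op h‖) * (‖op h⁻¹‖ * ‖op g⁻¹‖) := by
        gcongr <;> exact norm_mul_le _ _
    _ = _ := by unfold cond; ring

theorem cond_one_le : cond (1 : GL (Fin d) ℝ) ≤ 1 := by
  have : ‖(1 : EuclideanSpace ℝ (Fin d) →L[ℝ] EuclideanSpace ℝ (Fin d))‖ ≤ 1 :=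
    ContinuousLinearMap.norm_id_le
  rw [cond, inv_one, op_one]
  exact mul_le_one₀ this (norm_nonneg _) this

theorem one_le_cond [NeZero d] (h : GL (Fin d) ℝ) : 1 ≤ cond h := by
  have h1 : ‖op h * op h⁻¹‖ ≤ cond h := norm_mul_le _ _
  rw [← op_mul, mul_inv_cancel, op_one, norm_one] at h1
  exact h1

/-- The inverse `σ_{i+1} / σ_i` of the `i`-th singular value gap. -/
def gapRatio (i : ℕ) (g : GL (Fin d) ℝ) : ℝ := sv i g / sv (i - 1) g

/-! ### Gap ratio of a product, and the position of Ξ_i -/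

section GapRatio

variable {i : ℕ}

theorem gapRatio_pos (hid : i < d) (g : GL (Fin d) ℝ) : 0 < gapRatio i g :=
  div_pos (sv_pos hid g) (sv_pos (by omega) g)

theorem gapRatio_eq_exp (hid : i < d) (g : GL (Fin d) ℝ) :
    gapRatio i g = Real.exp (-(mu i g - mu (i + 1) g)) := by
  have h1 : mu i g = Real.log (sv (i - 1) g) := rfl
  have h2 : mu (i + 1) g = Real.log (sv i g) := rfl
  rw [h1, h2, neg_sub, Real.exp_sub, Real.exp_log (sv_pos hid g), Real.exp_log (sv_pos (by omega) g)]
  rfl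

theorem mu_lt_iff (hid : i < d) (g : GL (Fin d) ℝ) : mu (i + 1) g < mu i g ↔ gapRatio i g < 1 := by
  rw [gapRatio_eq_exp hid, Real.exp_lt_one_iff]
  constructor <;> intro h <;> linarith

/-- The numerator grows by at most ‖h‖; writing g = (gh)h⁻¹ shows that the denominator shrinks by at
most ‖h⁻¹‖. -/
theorem gapRatio_mul_right_le (hid : i < d) (g h : GL (Fin d) ℝ) :
    gapRatio i (g * h) ≤ cond h * gapRatio i g := by
  have hi' : i - 1 < d := by omega
  have h1 := sv_mul_le_right g h hid
  have h2 := sv_mul_le_right (g * h) h⁻¹ hi'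
  rw [mul_inv_cancel_right] at h2
  rw [gapRatio, gapRatio, cond, ← mul_div_assoc, div_le_div_iff₀ (sv_pos hi' _) (sv_pos hi' _)]
  have h3 := (sv_pos hi' g).le
  have h4 := (sv_pos hid g).le
  calc _ ≤ (‖op h‖ * sv i g) * (‖op h⁻¹‖ * sv (i - 1) (g * h)) := by gcongr
    _ = _ := by ring

theorem gapRatio_mul_left_le (hid : i < d) (g h : GL (Fin d) ℝ) :
    gapRatio i (h * g) ≤ cond h * gapRatio i g := by
  have hi' : i - 1 < d := by omega
  have h1 := sv_mul_le_left g h hid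
  have h2 := sv_mul_le_left (h * g) h⁻¹ hi'
  rw [inv_mul_cancel_left] at h2
  rw [gapRatio, gapRatio, cond, ← mul_div_assoc, div_le_div_iff₀ (sv_pos hi' _) (sv_pos hi' _)]
  have h3 := (sv_pos hi' g).le
  have h4 := (sv_pos hid g).le
  calc _ ≤ (‖op h‖ * sv i g) * (‖op h⁻¹‖ * sv (i - 1) (h * g)) := by gcongr
    _ = _ := by ring

theorem gapRatio_one (hid : i < d) : gapRatio i (1 : GL (Fin d) ℝ) = 1 := by
  have key : ∀ k < d, sv k (1 : GL (Fin d) ℝ) = 1 := by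
    intro k hk
    refine le_antisymm (sv_le _ hk (Y := ⊤) (by simp) (by simp)) (le_sv _ (X := ⊤) (by simpa) (by simp))
  rw [gapRatio, key i hid, key _ (by omega), div_one]

/-- Since gg^t(gx) = g(g^t g x), the map g carries eigenvectors of g^t g to eigenvectors of gg^t
with the same eigenvalue. The strict gap keeps the singular vectors of index at least i out of these
eigenspaces. -/
theorem Xi_eq_map (hi : 1 ≤ i) (hid : i < d) {g : GL (Fin d) ℝ} (hg : gapRatio i g < 1) :
    Xi i g = (rightSpan (Matrix.toEuclideanLin (g : Matrix (Fin d) (Fin d) ℝ)) (Set.Iio i)).map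
      (toEquiv g).toLinearMap := by
  set T := Matrix.toEuclideanLin (g : Matrix (Fin d) (Fin d) ℝ) with hT
  have hTx : ∀ x, (toEquiv g).toLinearMap x = T x := fun x => rfl
  have hexp : ∀ k, 1 ≤ k → k ≤ i → Real.exp (2 * mu k g) = T.singularValues (k - 1) ^ 2 := by
    intro k _ hk
    have : 0 < sv (k - 1) g := sv_pos (by omega) g
    rw [two_mul, Real.exp_add]
    change Real.exp (Real.log (sv (k-1) g)) * Real.exp (Real.log (sv (k-1) g)) = sv (k-1) g ^ 2
    rw [Real.exp_log this, sq]
  have hadj : ∀ x, Matrix.toEuclideanLin ((g : Matrix (Fin d) (Fin d) ℝ) *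
      (g : Matrix (Fin d) (Fin d) ℝ).transpose) x = T (adjoint T x) := by
    intro x
    rw [hT, ← Matrix.toEuclideanLin_conjTranspose_eq_adjoint, Matrix.conjTranspose_eq_transpose_of_trivial]
    simp [Matrix.toLpLin_apply, Matrix.mulVec_mulVec]
  have hlt : T.singularValues i < T.singularValues (i - 1) := by
    rw [gapRatio, div_lt_one (sv_pos (by omega) g)] at hg
    exact hg
  apply le_antisymm
  · refine iSup₂_le fun k hk v hv => ?_
    rw [Finset.mem_Icc] at hk
    rw [Module.End.mem_eigenspace_iff, hadj, hexp k hk.1 hk.2] at hv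
    obtain ⟨x, rfl⟩ := (toEquiv g).surjective v
    change T (adjoint T (T x)) = T.singularValues (k - 1) ^ 2 • T x at hv
    rw [← map_smul] at hv
    have hv' := (toEquiv g).injective hv
    refine ⟨x, ?_, rfl⟩
    rw [SetLike.mem_coe, mem_rightSpan]
    intro j hj
    have h1 := inner_rightBasis_adjoint T j x
    rw [hv', inner_smul_right] at h1
    have h2 : T.singularValues j < T.singularValues (k - 1) :=
      (T.singularValues_antitone (by simpa using hj)).trans_lt
        (hlt.trans_le (T.singularValues_antitone (by omega)))
    have h3 : T.singularValues j ^ 2 < T.singularValues (k - 1) ^ 2 :=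
      pow_lt_pow_left₀ h2 (T.singularValues_nonneg _) two_ne_zero
    have h4 : (T.singularValues (k - 1) ^ 2 - T.singularValues j ^ 2) *
        inner ℝ (rightBasis T j) x = 0 := by linear_combination h1
    exact (mul_eq_zero.1 h4).resolve_left (by linarith [h3])
  · rw [rightSpan, Submodule.map_span, Submodule.span_le]
    rintro _ ⟨_, ⟨j, hj, rfl⟩, rfl⟩
    have hj' : (j : ℕ) < i := hj
    rw [SetLike.mem_coe]
    have : Module.End.eigenspace (Matrix.toEuclideanLin ((g : Matrix (Fin d) (Fin d) ℝ) *
        (g : Matrix (Fin d) (Fin d) ℝ).transpose)) (Real.exp (2 * mu (j + 1) g)) ≤ Xi i g :=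
      le_iSup₂_of_le (f := fun k (_ : k ∈ Finset.Icc 1 i) => Module.End.eigenspace
        (Matrix.toEuclideanLin ((g : Matrix (Fin d) (Fin d) ℝ) *
        (g : Matrix (Fin d) (Fin d) ℝ).transpose)) (Real.exp (2 * mu k g))) ((j : ℕ) + 1)
        (by simp; omega) le_rfl
    refine this ?_
    rw [Module.End.mem_eigenspace_iff, hadj, hexp _ (by omega) (by omega), hTx,
      adjoint_apply_rightBasis, map_smul]
    simp

theorem finrank_Xi (hi : 1 ≤ i) (hid : i < d) {g : GL (Fin d) ℝ} (hg : gapRatio i g < 1) :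
    finrank ℝ (Xi i g) = i := by
  rw [Xi_eq_map hi hid hg, LinearEquiv.finrank_map_eq, finrank_rightSpan_Iio _ (by simpa using hid.le)]

theorem le_norm_of_mem_Xi (hi : 1 ≤ i) (hid : i < d) {g : GL (Fin d) ℝ} (hg : gapRatio i g < 1)
    {x : EuclideanSpace ℝ (Fin d)} (hx : op g x ∈ Xi i g) : sv (i - 1) g * ‖x‖ ≤ ‖op g x‖ := by
  rw [Xi_eq_map hi hid hg] at hx
  obtain ⟨y, hy, hyx⟩ := hx
  obtain rfl : y = x := (toEquiv g).injective (hyx.trans (toEquiv_apply g x).symm)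
  have h := le_norm_apply_of_mem_rightSpan
    (Matrix.toEuclideanLin (g : Matrix (Fin d) (Fin d) ℝ)) (k := i - 1) (x := y) (by
      have : Set.Iic (i - 1) = Set.Iio i := by ext; simp; omega
      rwa [this])
  rwa [toEuclideanLin_apply_eq_op] at h

/-- The witness is the image of the projection of x to the top i right singular vectors; the
remainder is stretched by at most σ_{i+1}. -/
theorem exists_mem_Xi_norm_sub_le (hi : 1 ≤ i) (hid : i < d) {g : GL (Fin d) ℝ}
    (hg : gapRatio i g < 1) (x : EuclideanSpace ℝ (Fin d)) :
    ∃ v ∈ Xi i g, ‖op g x - v‖ ≤ sv i g * ‖x‖ := by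
  set T := Matrix.toEuclideanLin (g : Matrix (Fin d) (Fin d) ℝ)
  set X := rightSpan T (Set.Iio i)
  refine ⟨op g (X.starProjection x), ?_, ?_⟩
  · rw [Xi_eq_map hi hid hg]
    exact ⟨_, X.starProjection_apply_mem x, toEquiv_apply _ _⟩
  · rw [← map_sub]
    have h1 : x - X.starProjection x ∈ rightSpan T (Set.Ici i) := by
      rw [rightSpan_Ici_eq_orthogonal]
      exact X.sub_starProjection_mem_orthogonal x
    have h2 := norm_apply_le_of_mem_rightSpan T h1
    rw [toEuclideanLin_apply_eq_op] at h2
    refine h2.trans (mul_le_mul_of_nonneg_left ?_ (sv_pos hid g).le)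
    rw [← Submodule.starProjection_orthogonal_val]
    exact Submodule.norm_starProjection_apply_le _ _

end GapRatio

end

section

open Module LinearMap

/-! ### The Grassmannian as a metric object -/

section Projections

variable {E : Type*} [NormedAddCommGroup E] [InnerProductSpace ℝ E] [FiniteDimensional ℝ E]

theorem norm_sub_starProjection_le {V : Submodule ℝ E} {v : E} (hv : v ∈ V) (w : E) :
    ‖w - V.starProjection w‖ ≤ ‖w - v‖ := by
  rw [Submodule.starProjection_minimal]
  exact ciInf_le (f := fun x : V => ‖w - x‖) ⟨0, by rintro _ ⟨x, rfl⟩; positivity⟩ ⟨v, hv⟩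

theorem norm_starProjection_sub_le_two (V W : Submodule ℝ E) :
    ‖V.starProjection - W.starProjection‖ ≤ 2 := by
  refine (norm_sub_le _ _).trans ?_
  linarith [V.starProjection_norm_le, W.starProjection_norm_le]

/-- Closeness of W to V is one-sided, but for small ε the projection W → V is injective, hence onto
by equality of dimensions, so V is 2ε-close to W. Splitting x along W and its orthogonal complement
then gives 3ε. -/
theorem norm_starProjection_sub_le {V W : Submodule ℝ E} (hVW : finrank ℝ V = finrank ℝ W)
    {ε : ℝ} (hε : 0 ≤ ε) (h : ∀ w ∈ W, ∃ v ∈ V, ‖w - v‖ ≤ ε * ‖w‖) :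
    ‖V.starProjection - W.starProjection‖ ≤ 4 * ε := by
  rcases le_or_gt ε (1 / 2) with hε' | hε'
  swap
  · exact (norm_starProjection_sub_le_two V W).trans (by linarith)
  have hA : ∀ w ∈ W, ‖w - V.starProjection w‖ ≤ ε * ‖w‖ := by
    intro w hw
    obtain ⟨v, hv, hvw⟩ := h w hw
    exact (norm_sub_starProjection_le hv w).trans hvw
  have hA' : ∀ w ∈ W, ‖w‖ ≤ 2 * ‖V.starProjection w‖ := by
    intro w hw
    have h1 := hA w hw
    have h2 := norm_sub_norm_le w (V.starProjection w)
    nlinarith [norm_nonneg w]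
  have hB : ∀ v ∈ V, ‖v - W.starProjection v‖ ≤ 2 * ε * ‖v‖ := by
    let f : W →ₗ[ℝ] V := (V.orthogonalProjectionOnto : E →ₗ[ℝ] V) ∘ₗ W.subtype
    have hf : ∀ w : W, ((f w : V) : E) = V.starProjection w := fun w => rfl
    have hinj : Function.Injective f := by
      rw [injective_iff_map_eq_zero]
      intro w hw
      have h1 := hA' w w.2
      rw [← hf, hw] at h1
      simpa using h1
    have hsurj := (LinearMap.injective_iff_surjective_of_finrank_eq_finrank hVW.symm).1 hinj
    intro v hv
    obtain ⟨w, hw⟩ := hsurj ⟨v, hv⟩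
    have hwv : V.starProjection (w : E) = v := by rw [← hf, hw]
    have h1 := hA w w.2
    have h2 := hA' w w.2
    rw [hwv] at h1 h2
    refine (norm_sub_starProjection_le w.2 v).trans ?_
    rw [norm_sub_rev]
    nlinarith
  refine ContinuousLinearMap.opNorm_le_bound _ (by positivity) fun x => ?_
  have hx : (V.starProjection - W.starProjection) x =
      V.starProjection (x - W.starProjection x) -
        (W.starProjection x - V.starProjection (W.starProjection x)) := by
    simp
  have h1 := hA _ (W.starProjection_apply_mem x)
  have h2 := W.norm_starProjection_apply_le x
  -- By duality: with y orthogonal to W and z its projection to V, ‖z‖² = ⟨z, y⟩ = ⟨z - P_W z, y⟩,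
  -- and z is 2ε-close to W.
  have h3 : ‖V.starProjection (x - W.starProjection x)‖ ≤ 2 * ε * ‖x‖ := by
    set y := x - W.starProjection x with hy
    have hy' : ‖y‖ ≤ ‖x‖ := by
      rw [hy, ← Submodule.starProjection_orthogonal_val]
      exact Submodule.norm_starProjection_apply_le _ _
    have hyW : y ∈ Wᗮ := W.sub_starProjection_mem_orthogonal x
    set z := V.starProjection y with hz
    have hzV : z ∈ V := V.starProjection_apply_mem y
    have e1 : inner ℝ z z = inner ℝ z y := by
      have := V.starProjection_inner_eq_zero y z hzV
      rw [inner_sub_left, sub_eq_zero] at this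
      rw [real_inner_comm y z, this]
    have e2 : inner ℝ z y = inner ℝ (z - W.starProjection z) y := by
      rw [inner_sub_left, (W.mem_orthogonal y).1 hyW _ (W.starProjection_apply_mem z), sub_zero]
    have e3 : ‖z‖ * ‖z‖ ≤ (2 * ε * ‖y‖) * ‖z‖ := by
      rw [← real_inner_self_eq_norm_mul_norm, e1, e2]
      refine (real_inner_le_norm _ _).trans ?_
      have := hB z hzV
      nlinarith [norm_nonneg y]
    rcases eq_or_ne z 0 with h0 | h0
    · rw [h0, norm_zero]; positivity
    · exact (le_of_mul_le_mul_right e3 (norm_pos_iff.2 h0)).trans (by gcongr)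
  rw [hx]
  refine (norm_sub_le _ _).trans ?_
  nlinarith [norm_nonneg x]

theorem finrank_eq_of_norm_starProjection_sub_lt_one {V W : Submodule ℝ E}
    (h : ‖V.starProjection - W.starProjection‖ < 1) : finrank ℝ V = finrank ℝ W := by
  have key : ∀ V W : Submodule ℝ E, ‖V.starProjection - W.starProjection‖ < 1 →
      finrank ℝ V ≤ finrank ℝ W := by
    intro V W h
    let f : V →ₗ[ℝ] W := (W.orthogonalProjectionOnto : E →ₗ[ℝ] W) ∘ₗ V.subtype
    have hf : ∀ w : V, ((f w : W) : E) = W.starProjection w := fun w => rfl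
    refine LinearMap.finrank_le_finrank_of_injective (f := f) ?_
    rw [injective_iff_map_eq_zero]
    intro v hv
    by_contra hv0
    have h1 : (V.starProjection - W.starProjection) (v : E) = v := by
      simp [← hf, hv]
    have h2 := (V.starProjection - W.starProjection).le_opNorm (v : E)
    rw [h1] at h2
    have h3 : 0 < ‖(v : E)‖ := norm_pos_iff.2 (by simpa using hv0)
    nlinarith
  exact le_antisymm (key V W h) (key W V (by rwa [norm_sub_rev]))

end Projections

/-! ### Distance on the Grassmannian, and Ξ_i as a point of it -/

variable {d i : ℕ}

/-- The distance of the projections onto two planes. -/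
def grDist (V W : Gr d i) : ℝ := ‖V.1.starProjection - W.1.starProjection‖

theorem grDist_nonneg (V W : Gr d i) : 0 ≤ grDist V W := norm_nonneg _

theorem grDist_comm (V W : Gr d i) : grDist V W = grDist W V := norm_sub_rev _ _

theorem grDist_triangle (U V W : Gr d i) : grDist U W ≤ grDist U V + grDist V W :=
  norm_sub_le_norm_sub_add_norm_sub _ _ _

theorem eq_of_grDist_eq_zero {V W : Gr d i} (h : grDist V W = 0) : V = W :=
  Subtype.ext (Submodule.starProjection_inj.1 (sub_eq_zero.1 (norm_eq_zero.1 h)))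

theorem grDist_le {V W : Gr d i} {ε : ℝ} (hε : 0 ≤ ε)
    (h : ∀ w ∈ W.1, ∃ v ∈ V.1, ‖w - v‖ ≤ ε * ‖w‖) : grDist V W ≤ 4 * ε :=
  norm_starProjection_sub_le (V.2.trans W.2.symm) hε h

theorem grDist_le_two (V W : Gr d i) : grDist V W ≤ 2 := norm_starProjection_sub_le_two _ _

theorem tendsto_gr_iff {α : Type*} {l : Filter α} {W : α → Gr d i} {V : Gr d i} :
    Tendsto W l (𝓝 V) ↔ Tendsto (fun a => grDist (W a) V) l (𝓝 0) := by
  have : IsInducing (fun V : Gr d i => V.1.starProjection) := ⟨rfl⟩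
  rw [this.tendsto_nhds_iff, tendsto_iff_norm_sub_tendsto_zero]
  rfl

theorem nhds_gr_basis (V : Gr d i) :
    (𝓝 V).HasBasis (fun ε : ℝ => 0 < ε) fun ε => {W | grDist W V < ε} := by
  have h : IsInducing (fun V : Gr d i => V.1.starProjection) := ⟨rfl⟩
  rw [h.nhds_eq_comap]
  convert! (Metric.nhds_basis_ball).comap (fun V : Gr d i => V.1.starProjection) using 3
  ext W
  simp [grDist, dist_eq_norm]

theorem eq_of_tendsto_gr {α : Type*} {l : Filter α} [l.NeBot] {W : α → Gr d i} {V V' : Gr d i}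
    (h : Tendsto W l (𝓝 V)) (h' : Tendsto W l (𝓝 V')) : V = V' := by
  rw [tendsto_gr_iff] at h h'
  refine eq_of_grDist_eq_zero (le_antisymm ?_ (grDist_nonneg _ _))
  have h2 := h.add h'
  rw [add_zero] at h2
  refine ge_of_tendsto' h2 fun a => ?_
  rw [grDist_comm (W a) V]
  exact grDist_triangle _ _ _

/-- Being a self-adjoint idempotent is a closed condition, and the rank of a projection is locally
constant. So the Grassmannian is closed in the space of operators, and Cauchy sequences of planes
converge. -/
theorem exists_gr_starProjection_eq {W : ℕ → Gr d i}
    {p : EuclideanSpace ℝ (Fin d) →L[ℝ] EuclideanSpace ℝ (Fin d)}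
    (h : Tendsto (fun n => (W n).1.starProjection) atTop (𝓝 p)) :
    ∃ V : Gr d i, V.1.starProjection = p := by
  have h1 : IsStarProjection p := by
    refine ⟨?_, ?_⟩
    · refine tendsto_nhds_unique ?_ h
      refine (h.mul h).congr fun n => ?_
      exact (W n).1.isIdempotentElem_starProjection
    · refine tendsto_nhds_unique ?_ h
      refine (((ContinuousLinearMap.adjoint (𝕜 := ℝ) (E := EuclideanSpace ℝ (Fin d))
        (F := EuclideanSpace ℝ (Fin d))).continuous.tendsto p).comp h).congr fun n => ?_
      exact isSelfAdjoint_starProjection (W n).1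
  obtain ⟨K, _, rfl⟩ := isStarProjection_iff_eq_starProjection.1 h1
  have h2 := tendsto_iff_norm_sub_tendsto_zero.1 h
  obtain ⟨n, hn⟩ := (h2.eventually (gt_mem_nhds one_pos)).exists
  exact ⟨⟨K, (finrank_eq_of_norm_starProjection_sub_lt_one hn).symm.trans (W n).2⟩, rfl⟩

theorem exists_tendsto_gr_of_geometric {W : ℕ → Gr d i} {C θ : ℝ} (hθ : θ < 1)
    (h : ∀ n, grDist (W n) (W (n + 1)) ≤ C * θ ^ n) :
    ∃ V : Gr d i, Tendsto W atTop (𝓝 V) ∧ ∀ n, grDist (W n) V ≤ C * θ ^ n / (1 - θ) := by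
  have h' : ∀ n, dist ((W n).1.starProjection) ((W (n + 1)).1.starProjection) ≤ C * θ ^ n :=
    fun n => (dist_eq_norm _ _).le.trans (h n)
  obtain ⟨p, hp⟩ := cauchySeq_tendsto_of_complete (cauchySeq_of_le_geometric θ C hθ h')
  obtain ⟨V, rfl⟩ := exists_gr_starProjection_eq hp
  refine ⟨V, tendsto_gr_iff.2 (tendsto_iff_norm_sub_tendsto_zero.1 hp), fun n => ?_⟩
  have := dist_le_of_le_geometric_of_tendsto θ C hθ h' hp n
  rwa [dist_eq_norm] at this

theorem grDist_move_le (h : GL (Fin d) ℝ) (V W : Gr d i) :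
    grDist (Gr.move h V) (Gr.move h W) ≤ 4 * (cond h * grDist V W) := by
  refine grDist_le (mul_nonneg (cond_nonneg h) (grDist_nonneg _ _)) ?_
  rintro _ ⟨w, hw, rfl⟩
  refine ⟨op h (V.1.starProjection w), ⟨_, V.1.starProjection_apply_mem w, toEquiv_apply _ _⟩, ?_⟩
  have e : (toEquiv h).toLinearMap w = op h w := toEquiv_apply _ _
  rw [e, ← map_sub]
  have h1 : ‖w - V.1.starProjection w‖ ≤ grDist V W * ‖w‖ := by
    have := (V.1.starProjection - W.1.starProjection).le_opNorm w
    rwa [_root_.sub_apply, W.1.starProjection_eq_self_iff.2 hw, norm_sub_rev] at this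
  have h2 := (op h⁻¹).le_opNorm (op h w)
  rw [op_inv_apply_self] at h2
  have h3 := (op h).le_opNorm (w - V.1.starProjection w)
  have := grDist_nonneg V W
  calc _ ≤ ‖op h‖ * (grDist V W * (‖op h⁻¹‖ * ‖op h w‖)) := by
        refine h3.trans ?_
        gcongr
        exact h1.trans (by gcongr)
    _ = _ := by unfold cond; ring

theorem tendsto_move (h : GL (Fin d) ℝ) {α : Type*} {l : Filter α} {W : α → Gr d i} {V : Gr d i}
    (hW : Tendsto W l (𝓝 V)) : Tendsto (fun a => Gr.move h (W a)) l (𝓝 (Gr.move h V)) := by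
  rw [tendsto_gr_iff] at hW ⊢
  have h2 : Tendsto (fun a => 4 * (cond h * grDist (W a) V)) l (𝓝 0) := by
    simpa using (hW.const_mul (cond h)).const_mul 4
  exact squeeze_zero (fun _ => grDist_nonneg _ _) (fun _ => grDist_move_le _ _ _) h2

theorem nonempty_gr (hid : i ≤ d) : Nonempty (Gr d i) :=
  ⟨⟨rightSpan (0 : EuclideanSpace ℝ (Fin d) →ₗ[ℝ] EuclideanSpace ℝ (Fin d)) (Set.Iio i),
    finrank_rightSpan_Iio _ (by simpa using hid)⟩⟩

open Classical in
/-- `Ξ_i(g)` as a point of the Grassmannian, with an arbitrary value if `g` has no gap. -/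
def xiGr (hid : i < d) (g : GL (Fin d) ℝ) : Gr d i :=
  if h : finrank ℝ (Xi i g) = i then ⟨Xi i g, h⟩ else (nonempty_gr hid.le).some

theorem xiGr_val (hi : 1 ≤ i) (hid : i < d) {g : GL (Fin d) ℝ} (hg : gapRatio i g < 1) :
    (xiGr hid g).1 = Xi i g := by
  have h := finrank_Xi hi hid hg
  have : xiGr hid g = ⟨Xi i g, h⟩ := dif_pos h
  rw [this]

/-- A vector u = ghx of Ξ_i(gh) lies within σ_{i+1}(g)‖hx‖ of Ξ_i(g), while ‖u‖ ≥ σ_i(gh)‖x‖, and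
σ_i(gh) is at least σ_i(g)/‖h⁻¹‖. -/
theorem grDist_xiGr_mul_right (hi : 1 ≤ i) (hid : i < d) (g h : GL (Fin d) ℝ) :
    grDist (xiGr hid g) (xiGr hid (g * h)) ≤ 4 * (cond h * gapRatio i g) := by
  have : NeZero d := ⟨by omega⟩
  have hpos := gapRatio_pos hid g
  -- When the product is at least 1 the claim is trivial, as distances never exceed 2. Otherwise
  -- both g and gh have a gap, so `xiGr` takes its true value at both.
  rcases le_or_gt 1 (cond h * gapRatio i g) with h1 | h1
  · exact (grDist_le_two _ _).trans (by linarith)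
  have hg : gapRatio i g < 1 := by nlinarith [one_le_cond h]
  have hgh := (gapRatio_mul_right_le hid g h).trans_lt h1
  have hi' : i - 1 < d := by omega
  refine grDist_le (mul_nonneg (cond_nonneg h) hpos.le) ?_
  rw [xiGr_val hi hid hg, xiGr_val hi hid hgh]
  intro u hu
  obtain ⟨x, rfl⟩ : ∃ x, op (g * h) x = u := ⟨_, op_apply_inv_self (g * h) u⟩
  obtain ⟨v, hv, hv'⟩ := exists_mem_Xi_norm_sub_le hi hid hg (op h x)
  refine ⟨v, hv, ?_⟩
  rw [← op_mul_apply] at hv'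
  have h2 := le_norm_of_mem_Xi hi hid hgh hu
  have h3 := sv_mul_le_right (g * h) h⁻¹ hi'
  rw [mul_inv_cancel_right] at h3
  have h4 : sv i g = gapRatio i g * sv (i - 1) g := by
    rw [gapRatio, div_mul_cancel₀ _ (sv_pos hi' g).ne']
  calc _ ≤ sv i g * (‖op h‖ * ‖x‖) :=
        hv'.trans (mul_le_mul_of_nonneg_left ((op h).le_opNorm x) (sv_pos hid g).le)
    _ = gapRatio i g * ‖op h‖ * (sv (i - 1) g * ‖x‖) := by rw [h4]; ring
    _ ≤ gapRatio i g * ‖op h‖ * (‖op h⁻¹‖ * ‖op (g * h) x‖) := by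
        refine mul_le_mul_of_nonneg_left ?_ (by positivity)
        calc _ ≤ ‖op h⁻¹‖ * sv (i - 1) (g * h) * ‖x‖ := by gcongr
          _ = ‖op h⁻¹‖ * (sv (i - 1) (g * h) * ‖x‖) := by ring
          _ ≤ _ := by gcongr
    _ = _ := by unfold cond; ring

theorem grDist_xiGr_mul_left (hi : 1 ≤ i) (hid : i < d) (g h : GL (Fin d) ℝ) :
    grDist (xiGr hid (h * g)) (Gr.move h (xiGr hid g)) ≤ 4 * (cond h * gapRatio i g) := by
  have : NeZero d := ⟨by omega⟩
  have hpos := gapRatio_pos hid g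
  rcases le_or_gt 1 (cond h * gapRatio i g) with h1 | h1
  · exact (grDist_le_two _ _).trans (by linarith)
  have hg : gapRatio i g < 1 := by nlinarith [one_le_cond h]
  have hgh := (gapRatio_mul_left_le hid g h).trans_lt h1
  have hi' : i - 1 < d := by omega
  refine grDist_le (mul_nonneg (cond_nonneg h) hpos.le) ?_
  rw [xiGr_val hi hid hgh]
  rintro _ ⟨w, hw, rfl⟩
  rw [SetLike.mem_coe, xiGr_val hi hid hg] at hw
  have e : (toEquiv h).toLinearMap w = op h w := toEquiv_apply _ _
  rw [e]
  obtain ⟨x, rfl⟩ : ∃ x, op g x = w := ⟨_, op_apply_inv_self g w⟩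
  obtain ⟨v, hv, hv'⟩ := exists_mem_Xi_norm_sub_le hi hid hgh x
  refine ⟨v, hv, ?_⟩
  rw [op_mul_apply] at hv'
  have h2 := le_norm_of_mem_Xi hi hid hg hw
  have h3 := sv_mul_le_left g h hid
  have h4 : sv i g = gapRatio i g * sv (i - 1) g := by
    rw [gapRatio, div_mul_cancel₀ _ (sv_pos hi' g).ne']
  have h5 := (op h⁻¹).le_opNorm (op h (op g x))
  rw [op_inv_apply_self] at h5
  calc _ ≤ (‖op h‖ * sv i g) * ‖x‖ := hv'.trans (by gcongr)
    _ = ‖op h‖ * gapRatio i g * (sv (i - 1) g * ‖x‖) := by rw [h4]; ring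
    _ ≤ ‖op h‖ * gapRatio i g * (‖op h⁻¹‖ * ‖op h (op g x)‖) := by
        exact mul_le_mul_of_nonneg_left (h2.trans h5) (by positivity)
    _ = _ := by unfold cond; ring

end

section

open Module LinearMap

/-! ### Spectral splitting at a given modulus -/

section Polynomials

open Polynomial

/-- Both roots have the same minimal polynomial, which divides (X - z)(X - z̄); so w is z or its
conjugate. -/
theorem norm_eq_of_aeval_irreducible {f : ℝ[X]} (hf : Irreducible f) {z w : ℂ}
    (hz : aeval z f = 0) (hw : aeval w f = 0) : ‖z‖ = ‖w‖ := by
  have h1 : minpoly ℝ z = minpoly ℝ w := by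
    rw [← minpoly.eq_of_irreducible hf hz, ← minpoly.eq_of_irreducible hf hw]
  let g : ℝ[X] := X ^ 2 - C (2 * z.re) * X + C (‖z‖ ^ 2)
  have hg : ∀ u : ℂ, aeval u g = (u - z) * (u - (starRingEnd ℂ) z) := by
    intro u
    have e1 : ((2 * z.re : ℝ) : ℂ) = z + (starRingEnd ℂ) z := by
      rw [Complex.add_conj]
    have e2 : ((‖z‖ ^ 2 : ℝ) : ℂ) = z * (starRingEnd ℂ) z := by
      rw [Complex.mul_conj, Complex.normSq_eq_norm_sq]
    have e3 : aeval u g = u ^ 2 - ((2 * z.re : ℝ) : ℂ) * u + ((‖z‖ ^ 2 : ℝ) : ℂ) := by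
      simp [g]
    rw [e3, e1, e2]; ring
  have h2 : minpoly ℝ z ∣ g := minpoly.dvd ℝ z (by rw [hg, sub_self, zero_mul])
  rw [h1] at h2
  obtain ⟨k, hk⟩ := h2
  have h3 : aeval w g = 0 := by rw [hk, map_mul, minpoly.aeval, zero_mul]
  rw [hg, mul_eq_zero, sub_eq_zero, sub_eq_zero] at h3
  rcases h3 with rfl | rfl
  · rfl
  · simp

theorem exists_factorization_of_modulus (r : ℝ) (P : ℝ[X]) (hP : P ≠ 0)
    (hr : ∀ z : ℂ, aeval z P = 0 → ‖z‖ ≠ r) :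
    ∃ p q : ℝ[X], P = p * q ∧ (∀ z : ℂ, aeval z p = 0 → r < ‖z‖) ∧
      ∀ z : ℂ, aeval z q = 0 → ‖z‖ < r := by
  have hunit : ∀ u : ℝ[X], IsUnit u → ∀ z : ℂ, aeval z u ≠ 0 := fun u hu z =>
    (hu.map (aeval z)).ne_zero
  induction P using WfDvdMonoid.induction_on_irreducible with
  | zero => exact absurd rfl hP
  | unit u hu =>
    exact ⟨u, 1, by simp, fun z hz => absurd hz (hunit u hu z), fun z hz => by simp at hz⟩
  | mul P f hP0 hf ih =>
    obtain ⟨p, q, rfl, hp, hq⟩ := ih hP0 fun z hz => hr z (by rw [map_mul, hz, mul_zero])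
    by_cases h : ∃ z : ℂ, aeval z f = 0 ∧ ‖z‖ < r
    · obtain ⟨z, hz, hzr⟩ := h
      refine ⟨p, f * q, by ring, hp, fun w hw => ?_⟩
      rw [map_mul, mul_eq_zero] at hw
      rcases hw with hw | hw
      · rwa [norm_eq_of_aeval_irreducible hf hw hz]
      · exact hq w hw
    · refine ⟨f * p, q, by ring, fun w hw => ?_, hq⟩
      rw [map_mul, mul_eq_zero] at hw
      rcases hw with hw | hw
      · push Not at h
        exact lt_of_le_of_ne (h w hw) (hr w (by rw [map_mul, hw, zero_mul])).symm
      · exact hp w hw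

end Polynomials

/-! ### Growth of powers and spectral projections -/

variable {d i : ℕ}

/-- The action of a real matrix on `ℂ^d`. -/
def complexify (d : ℕ) : Matrix (Fin d) (Fin d) ℝ →ₐ[ℝ]
    (EuclideanSpace ℂ (Fin d) →L[ℂ] EuclideanSpace ℂ (Fin d)) :=
  ((Matrix.toEuclideanCLM (𝕜 := ℂ) (n := Fin d)).toAlgEquiv.toAlgHom.restrictScalars ℝ).comp
    (Complex.ofRealAm.mapMatrix)

theorem norm_toEuclideanCLM_le_complexify (M : Matrix (Fin d) (Fin d) ℝ) :
    ‖Matrix.toEuclideanCLM (𝕜 := ℝ) (n := Fin d) M‖ ≤ ‖complexify d M‖ := by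
  refine ContinuousLinearMap.opNorm_le_bound _ (norm_nonneg _) fun x => ?_
  let c : EuclideanSpace ℝ (Fin d) → EuclideanSpace ℂ (Fin d) :=
    fun x => WithLp.toLp 2 fun j => (x j : ℂ)
  have hc : ∀ x, ‖c x‖ = ‖x‖ := fun x => by
    simp [c, EuclideanSpace.norm_eq]
  have hM : complexify d M (c x) = c (Matrix.toEuclideanCLM (𝕜 := ℝ) (n := Fin d) M x) := by
    ext j
    simp [complexify, c, Matrix.mulVec, dotProduct]
  rw [← hc, ← hM, ← hc x]
  exact ContinuousLinearMap.le_opNorm _ _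

/-- Gelfand's formula over ℂ: the spectral radius is less than r because every eigenvalue is, and
any s strictly between them works for large n. -/
theorem exists_pow_bound (hd : 0 < d) (N : Matrix (Fin d) (Fin d) ℝ) {r : ℝ} (hr : 0 < r)
    (h : ∀ (z : ℂ) (v : EuclideanSpace ℂ (Fin d)), v ≠ 0 → complexify d N v = z • v → ‖z‖ < r) :
    ∃ C s : ℝ, 0 < C ∧ 0 < s ∧ s < r ∧ ∀ n, ‖Matrix.toEuclideanCLM (𝕜 := ℝ) (n := Fin d) (N ^ n)‖ ≤ C * s ^ n := by
  have : NeZero d := ⟨hd.ne'⟩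
  set A := complexify d N with hA
  have h1 : spectralRadius ℂ A < (r.toNNReal : ENNReal) := by
    refine spectrum.spectralRadius_lt_of_forall_lt _ fun z hz => ?_
    have hz' : z ∈ spectrum ℂ (A : EuclideanSpace ℂ (Fin d) →ₗ[ℂ] EuclideanSpace ℂ (Fin d)) := by
      have e := AlgEquiv.spectrum_eq
        (Module.End.toContinuousLinearMap (𝕜 := ℂ) (EuclideanSpace ℂ (Fin d))).symm A
      rw [← e] at hz
      exact hz
    obtain ⟨v, hv⟩ := (Module.End.hasEigenvalue_iff_mem_spectrum.2 hz').exists_hasEigenvector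
    rw [← NNReal.coe_lt_coe, Real.coe_toNNReal _ hr.le]
    exact h z v hv.2 hv.apply_eq_smul
  obtain ⟨s, hs1, hs2⟩ := ENNReal.lt_iff_exists_nnreal_btwn.1 h1
  have hs0 : 0 < s := by
    by_contra h0
    have : s = 0 := le_antisymm (not_lt.1 h0) bot_le
    simp [this] at hs1
  have h2 := (spectrum.pow_nnnorm_pow_one_div_tendsto_nhds_spectralRadius A).eventually
    (gt_mem_nhds hs1)
  have h3 : ∀ᶠ n : ℕ in atTop, ‖Matrix.toEuclideanCLM (𝕜 := ℝ) (n := Fin d) (N ^ n)‖ ≤ (s : ℝ) ^ n := by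
    filter_upwards [h2, eventually_gt_atTop 0] with n hn hn0
    refine (norm_toEuclideanCLM_le_complexify _).trans ?_
    rw [map_pow, ← hA]
    have h4 : (‖A ^ n‖₊ : ENNReal) ≤ (s : ENNReal) ^ n := by
      have := ENNReal.rpow_le_rpow hn.le (Nat.cast_nonneg n)
      rwa [← ENNReal.rpow_mul, one_div, inv_mul_cancel₀ (by positivity), ENNReal.rpow_one,
        ENNReal.rpow_natCast] at this
    exact_mod_cast h4
  obtain ⟨n₀, hn₀⟩ := eventually_atTop.1 h3
  -- The sum absorbs the finitely many powers below `n₀`, where Gelfand's formula says nothing.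
  refine ⟨1 + ∑ n ∈ Finset.range n₀, ‖Matrix.toEuclideanCLM (𝕜 := ℝ) (n := Fin d) (N ^ n)‖ / (s : ℝ) ^ n, s,
    by positivity, by exact_mod_cast hs0, ?_, fun n => ?_⟩
  · have := ENNReal.coe_lt_coe.1 hs2
    rwa [← NNReal.coe_lt_coe, Real.coe_toNNReal _ hr.le] at this
  · have hsn : (0 : ℝ) < (s : ℝ) ^ n := by positivity
    rcases lt_or_ge n n₀ with hn | hn
    · rw [← div_le_iff₀ hsn]
      have := Finset.single_le_sum (f := fun n => ‖Matrix.toEuclideanCLM (𝕜 := ℝ) (n := Fin d) (N ^ n)‖ / (s : ℝ) ^ n)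
        (fun _ _ => by positivity) (Finset.mem_range.2 hn)
      linarith
    · refine (hn₀ n hn).trans (le_mul_of_one_le_left hsn.le ?_)
      have : 0 ≤ ∑ n ∈ Finset.range n₀, ‖Matrix.toEuclideanCLM (𝕜 := ℝ) (n := Fin d) (N ^ n)‖ / (s : ℝ) ^ n :=
        Finset.sum_nonneg fun _ _ => by positivity
      linarith

/-- Exponential bound for `A ^ n` on the range of a commuting idempotent. -/
theorem exists_pow_mul_idempotent_bound (hd : 0 < d) {A Q : Matrix (Fin d) (Fin d) ℝ}
    (hQ : Q * Q = Q) (hAQ : A * Q = Q * A) {r : ℝ} (hr : 0 < r)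
    (h : ∀ (z : ℂ) (v : EuclideanSpace ℂ (Fin d)), z ≠ 0 → v ≠ 0 → complexify d A v = z • v →
      complexify d Q v = v → ‖z‖ < r) :
    ∃ C s : ℝ, 0 < C ∧ 0 < s ∧ s < r ∧
      ∀ n, ‖Matrix.toEuclideanCLM (𝕜 := ℝ) (n := Fin d) (A ^ n * Q)‖ ≤ C * s ^ n := by
  -- An eigenvector of AQ with nonzero eigenvalue lies in the range of Q, hence is an eigenvector of
  -- A there.
  obtain ⟨C, s, hC, hs, hsr, hb⟩ := exists_pow_bound hd (A * Q) hr (by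
    intro z v hv hz
    rcases eq_or_ne z 0 with rfl | hz0
    · simpa using hr
    have h1 : complexify d Q v = v := by
      have e : complexify d Q (complexify d (A * Q) v) = complexify d (A * Q) v := by
        rw [← mul_apply_eq_comp, ← map_mul, ← mul_assoc, ← hAQ, mul_assoc, hQ]
      rw [hz, map_smul] at e
      exact smul_right_injective _ hz0 e
    refine h z v hz0 hv ?_ h1
    rwa [map_mul, mul_apply_eq_comp, h1] at hz)
  -- The extra ‖Q‖ covers n = 0, where A^n Q = Q differs from (AQ)^n = 1.
  refine ⟨C + ‖Matrix.toEuclideanCLM (𝕜 := ℝ) (n := Fin d) Q‖, s, by positivity, hs, hsr, fun n => ?_⟩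
  rcases n.eq_zero_or_pos with rfl | hn
  · simp [hC.le]
  · have h2 : A ^ n * Q = (A * Q) ^ n := by
      rw [(show Commute A Q from hAQ).mul_pow, (show IsIdempotentElem Q from hQ).pow_eq hn.ne']
    rw [h2]
    refine (hb n).trans ?_
    gcongr
    simp

/-- `Q` is a projection commuting with `g` such that `g` expands faster than `r` on the range of
`Q` and slower than `r` on its kernel. -/
structure IsSplitting (g : GL (Fin d) ℝ) (r : ℝ)
    (Q : EuclideanSpace ℝ (Fin d) →L[ℝ] EuclideanSpace ℝ (Fin d)) : Prop where
  idem : ∀ x, Q (Q x) = Q x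
  comm : ∀ x, op g (Q x) = Q (op g x)
  bounds : ∃ C s : ℝ, 0 < C ∧ 0 < s ∧ s < r ∧ ∀ (n : ℕ) (x : EuclideanSpace ℝ (Fin d)),
    ‖op (g ^ n) (x - Q x)‖ ≤ C * s ^ n * ‖x‖ ∧ r ^ n * ‖Q x‖ ≤ C * ‖op (g ^ n) (Q x)‖

open Polynomial in
theorem complexify_aeval_apply (M : Matrix (Fin d) (Fin d) ℝ) (p : ℝ[X]) {z : ℂ}
    {v : EuclideanSpace ℂ (Fin d)} (h : complexify d M v = z • v) :
    complexify d (aeval M p) v = aeval z p • v := by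
  induction p using Polynomial.induction_on' with
  | add p q hp hq => simp [hp, hq, add_smul]
  | monomial n a =>
    have hn : (complexify d M ^ n) v = z ^ n • v := by
      induction n with
      | zero => simp
      | succ n ih => rw [pow_succ, mul_apply_eq_comp, h, map_smul, ih, smul_smul, pow_succ']
    simp [aeval_monomial, hn, Algebra.algebraMap_eq_smul_one, mul_smul]

open Polynomial in
-- Factor the characteristic polynomial as pq, with the roots of p outside and those of q inside the
-- circle of radius r. A Bézout relation ap + bq = 1 and Cayley–Hamilton make (bq)(g) and (ap)(g)
-- complementary commuting idempotents. Power bounds for g on the second range and for g⁻¹ on the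
-- first give the two estimates.
theorem exists_isSplitting (hd : 0 < d) (g : GL (Fin d) ℝ) {r : ℝ} (hr : 0 < r)
    (h : ∀ z : ℂ, aeval z (g : Matrix (Fin d) (Fin d) ℝ).charpoly = 0 → ‖z‖ ≠ r) :
    ∃ Q, IsSplitting g r Q := by
  set M : Matrix (Fin d) (Fin d) ℝ := (g : Matrix (Fin d) (Fin d) ℝ) with hM
  set M' : Matrix (Fin d) (Fin d) ℝ := ((g⁻¹ : GL (Fin d) ℝ) : Matrix (Fin d) (Fin d) ℝ) with hM'
  have hMM' : M * M' = 1 := by rw [hM, hM', ← Units.val_mul, mul_inv_cancel, Units.val_one]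
  have hM'M : M' * M = 1 := by rw [hM, hM', ← Units.val_mul, inv_mul_cancel, Units.val_one]
  obtain ⟨p, q, hpq, hp, hq⟩ := exists_factorization_of_modulus r M.charpoly
    M.charpoly_monic.ne_zero h
  obtain ⟨a, b, hab⟩ : IsCoprime p q := by
    rw [Polynomial.isCoprime_iff_aeval_ne_zero_of_isAlgClosed ℝ ℂ]
    intro z
    by_contra! h
    exact lt_asymm (hp z h.1) (hq z h.2)
  have hzero : aeval M (p * q) = 0 := by rw [← hpq]; exact Matrix.aeval_self_charpoly M
  set Qp : Matrix (Fin d) (Fin d) ℝ := aeval M (b * q) with hQp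
  set Qm : Matrix (Fin d) (Fin d) ℝ := aeval M (a * p) with hQm
  have hsum : Qm + Qp = 1 := by rw [hQm, hQp, ← map_add, hab, map_one]
  have hmul : Qp * Qm = 0 := by
    rw [hQm, hQp, ← map_mul, show b * q * (a * p) = a * b * (p * q) by ring, map_mul, hzero, mul_zero]
  have hmul' : Qm * Qp = 0 := by
    rw [hQm, hQp, ← map_mul, show a * p * (b * q) = a * b * (p * q) by ring, map_mul, hzero, mul_zero]
  have hpp : Qp * Qp = Qp := by
    have : Qp * (Qm + Qp) = Qp := by rw [hsum, mul_one]
    rwa [mul_add, hmul, zero_add] at this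
  have hmm : Qm * Qm = Qm := by
    have : Qm * (Qm + Qp) = Qm := by rw [hsum, mul_one]
    rwa [mul_add, hmul', add_zero] at this
  have hcp : ∀ f : ℝ[X], M * aeval M f = aeval M f * M := fun f => by
    have : aeval M (X * f) = aeval M (f * X) := by rw [mul_comm]
    simpa using this
  have hcp' : M' * Qp = Qp * M' := by
    calc M' * Qp = M' * (Qp * M) * M' := by rw [mul_assoc, mul_assoc, hMM', mul_one]
      _ = Qp * M' := by rw [← hcp, ← mul_assoc, hM'M, one_mul]
  obtain ⟨C₁, s, hC₁, hs, hsr, hb₁⟩ := exists_pow_mul_idempotent_bound hd hmm (hcp _) hr (by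
    intro z v hz hv h1 h2
    refine hq z ?_
    have h3 : complexify d (aeval M q) (complexify d Qm v) = 0 := by
      rw [← mul_apply_eq_comp, ← map_mul, hQm, ← map_mul, show q * (a * p) = a * (p * q) by ring,
        map_mul, hzero, mul_zero]
      simp
    rw [h2, complexify_aeval_apply M q h1] at h3
    exact (smul_eq_zero.1 h3).resolve_right hv)
  obtain ⟨C₂, t, hC₂, ht, htr, hb₂⟩ := exists_pow_mul_idempotent_bound hd hpp hcp' (inv_pos.2 hr) (by
    intro z v hz hv h1 h2
    have h1' : complexify d M v = z⁻¹ • v := by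
      have e : complexify d M (complexify d M' v) = v := by
        rw [← mul_apply_eq_comp, ← map_mul, hMM']; simp
      rw [h1, map_smul] at e
      rw [eq_inv_smul_iff₀ hz]
      exact e
    have h3 : complexify d (aeval M p) (complexify d Qp v) = 0 := by
      rw [← mul_apply_eq_comp, ← map_mul, hQp, ← map_mul, show p * (b * q) = b * (p * q) by ring,
        map_mul, hzero, mul_zero]
      simp
    rw [h2, complexify_aeval_apply M p h1'] at h3
    have h4 := hp _ ((smul_eq_zero.1 h3).resolve_right hv)
    rw [norm_inv] at h4
    rwa [lt_inv_comm₀ (norm_pos_iff.2 hz) hr])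
  let Φ := Matrix.toEuclideanCLM (𝕜 := ℝ) (n := Fin d)
  have hΦ : ∀ (A B : Matrix (Fin d) (Fin d) ℝ) x, Φ (A * B) x = Φ A (Φ B x) := fun A B x => by
    rw [map_mul]; rfl
  have hopn : ∀ n, op (g ^ n) = Φ (M ^ n) := fun n => by
    simp [op, Φ, hM]
  refine ⟨Φ Qp, fun x => ?_, fun x => ?_, C₁ + C₂, s, by positivity, hs, hsr, fun n x => ⟨?_, ?_⟩⟩
  · rw [← hΦ, hpp]
  · change Φ M _ = Φ Qp (Φ M x)
    rw [← hΦ, ← hΦ, hcp]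
  · have e : x - Φ Qp x = Φ Qm x := by
      rw [sub_eq_iff_eq_add, ← _root_.add_apply, ← map_add, hsum, map_one]
      rfl
    rw [e, hopn, ← hΦ]
    refine (ContinuousLinearMap.le_opNorm _ _).trans ?_
    refine mul_le_mul_of_nonneg_right ((hb₁ n).trans ?_) (norm_nonneg _)
    gcongr
    linarith
  · have e : Φ Qp x = Φ (M' ^ n * Qp) (op (g ^ n) (Φ Qp x)) := by
      have hc : M ^ n * Qp = Qp * M ^ n := (show Commute M Qp from hcp _).pow_left n
      have hinv : M' ^ n * M ^ n = 1 := by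
        rw [← (show Commute M' M by rw [Commute, SemiconjBy, hMM', hM'M]).mul_pow, hM'M, one_pow]
      have hid : M' ^ n * Qp * (M ^ n * Qp) = Qp := by
        rw [hc, mul_assoc, ← mul_assoc Qp, hpp, ← hc, ← mul_assoc, hinv, one_mul]
      rw [hopn, ← hΦ (M ^ n), ← hΦ, hid]
    have h1 : ‖Φ Qp x‖ ≤ C₂ * t ^ n * ‖op (g ^ n) (Φ Qp x)‖ := by
      conv_lhs => rw [e]
      exact (ContinuousLinearMap.le_opNorm _ _).trans
        (mul_le_mul_of_nonneg_right (hb₂ n) (norm_nonneg _))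
    have h2 : r ^ n * t ^ n ≤ 1 := by
      rw [← mul_pow]
      refine pow_le_one₀ (by positivity) ?_
      have := mul_le_mul_of_nonneg_left htr.le hr.le
      rwa [mul_inv_cancel₀ hr.ne'] at this
    calc r ^ n * ‖Φ Qp x‖ ≤ r ^ n * (C₂ * t ^ n * ‖op (g ^ n) (Φ Qp x)‖) := by gcongr
      _ = (r ^ n * t ^ n) * (C₂ * ‖op (g ^ n) (Φ Qp x)‖) := by ring
      _ ≤ 1 * ((C₁ + C₂) * ‖op (g ^ n) (Φ Qp x)‖) := by
          gcongr
          linarith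
      _ = _ := one_mul _

end

section

open Module LinearMap

/-! ### Attracting fixed points -/

variable {d i : ℕ}

theorem le_of_forall_pow_le {a b c C : ℝ} (ha : 0 < a) (hb : 0 ≤ b) (hc : 0 < c)
    (h : ∀ᶠ n : ℕ in atTop, c * a ^ n ≤ C * b ^ n) : a ≤ b := by
  by_contra! hlt
  have h1 : Tendsto (fun n : ℕ => C * (b / a) ^ n) atTop (𝓝 0) := by
    simpa using (tendsto_pow_atTop_nhds_zero_of_lt_one (by positivity)
      ((div_lt_one ha).2 hlt)).const_mul C
  obtain ⟨n, hn, hn'⟩ := ((h1.eventually (gt_mem_nhds hc)).and h).exists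
  have : C * (b / a) ^ n * a ^ n = C * b ^ n := by
    rw [div_pow, mul_assoc, div_mul_cancel₀ _ (by positivity)]
  have h3 : 0 < a ^ n := by positivity
  nlinarith

theorem norm_op_pow_le (g : GL (Fin d) ℝ) (n : ℕ) (x) : ‖op (g ^ n) x‖ ≤ ‖op g‖ ^ n * ‖x‖ := by
  induction n with
  | zero => simp
  | succ n ih =>
    rw [pow_succ', op_mul_apply]
    calc _ ≤ ‖op g‖ * (‖op g‖ ^ n * ‖x‖) := ((op g).le_opNorm _).trans (by gcongr)
      _ = _ := by ring

namespace IsSplitting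

variable {g : GL (Fin d) ℝ} {r : ℝ} {Q : EuclideanSpace ℝ (Fin d) →L[ℝ] EuclideanSpace ℝ (Fin d)}

theorem pos (h : IsSplitting g r Q) : 0 < r := by
  obtain ⟨C, s, _, hs, hsr, _⟩ := h.bounds
  exact hs.trans hsr

theorem comm_pow (h : IsSplitting g r Q) (n : ℕ) (x) : op (g ^ n) (Q x) = Q (op (g ^ n) x) := by
  induction n with
  | zero => simp
  | succ n ih => rw [pow_succ', op_mul_apply, ih, h.comm, op_mul_apply]

theorem exists_le_sv (h : IsSplitting g r Q) {k : ℕ} (hk : k < finrank ℝ Q.range) :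
    ∃ c : ℝ, 0 < c ∧ ∀ n, c * r ^ n ≤ sv k (g ^ n) := by
  obtain ⟨C, s, hC, hs, hsr, hb⟩ := h.bounds
  refine ⟨C⁻¹, by positivity, fun n => le_sv _ hk ?_⟩
  rintro _ ⟨x, rfl⟩
  have := (hb n x).2
  rw [mul_assoc, inv_mul_le_iff₀ hC]
  exact this

theorem exists_sv_le (h : IsSplitting g r Q) {k : ℕ} (hkd : k < d) (hk : finrank ℝ Q.range ≤ k) :
    ∃ C : ℝ, 0 < C ∧ ∀ n, sv k (g ^ n) ≤ C * r ^ n := by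
  obtain ⟨C, s, hC, hs, hsr, hb⟩ := h.bounds
  refine ⟨C, hC, fun n => sv_le _ hkd (Y := Q.ker) ?_ ?_⟩
  · have := Q.toLinearMap.finrank_range_add_finrank_ker
    rw [finrank_euclideanSpace_fin] at this
    change finrank ℝ (LinearMap.range Q.toLinearMap) ≤ k at hk
    change d ≤ finrank ℝ (LinearMap.ker Q.toLinearMap) + k
    omega
  · intro x hx
    have hx' : Q x = 0 := hx
    have := (hb n x).1
    rw [hx', sub_zero] at this
    refine this.trans ?_
    gcongr

end IsSplitting

/-- Suppose no admissible radius has exactly i eigenvalues outside it. Then the count jumps from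
more than i to less than i across a critical radius r₀, so σ_i and σ_{i+1} of g^n both grow roughly
like r₀^n, against the exponential decay of their ratio. -/
theorem exists_isSplitting_finrank_eq (hi : 1 ≤ i) (hid : i < d) {g : GL (Fin d) ℝ} {C θ : ℝ}
    (hθ0 : 0 < θ) (hθ : θ < 1) (hg : ∀ n, gapRatio i (g ^ n) ≤ C * θ ^ n) :
    ∃ r Q, IsSplitting g r Q ∧ finrank ℝ Q.range = i := by
  have : NeZero d := ⟨by omega⟩
  have hi' : i - 1 < d := by omega
  by_contra! hne
  let P := (g : Matrix (Fin d) (Fin d) ℝ).charpoly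
  have hZ : {r : ℝ | ∃ z : ℂ, Polynomial.aeval z P = 0 ∧ ‖z‖ = r}.Finite := by
    have h1 : {z : ℂ | Polynomial.aeval z P = 0}.Finite := by
      refine (Polynomial.rootSet_finite P ℂ).subset fun z hz => ?_
      exact (Polynomial.mem_rootSet).2 ⟨(Matrix.charpoly_monic _).ne_zero, hz⟩
    exact h1.image (fun z => ‖z‖)
  have hex : ∀ a b : ℝ, 0 ≤ a → a < b → ∃ r Q, a < r ∧ r < b ∧ IsSplitting g r Q := by
    intro a b ha hab
    obtain ⟨r, hr, hr'⟩ := ((Set.Ioo_infinite hab).sdiff hZ).nonempty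
    obtain ⟨Q, hQ⟩ := exists_isSplitting (by omega) g (ha.trans_lt hr.1)
      fun z hz h => hr' ⟨z, hz, h⟩
    exact ⟨r, Q, hr.1, hr.2, hQ⟩
  -- Radii in S bound σ_{i+1}(g^n) from below. Since rank i is excluded, a splitting radius outside
  -- S has rank at most i - 1 and bounds σ_i(g^n) from above.
  let S : Set ℝ := {r | ∃ Q, IsSplitting g r Q ∧ i < finrank ℝ Q.range}
  have hS1 : ∀ r ∈ S, ∃ c : ℝ, 0 < c ∧ ∀ n, c * r ^ n ≤ sv i (g ^ n) := by
    rintro r ⟨Q, hQ, hQi⟩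
    exact hQ.exists_le_sv hQi
  have hS2 : ∀ r Q, IsSplitting g r Q → r ∉ S →
      ∃ C : ℝ, 0 < C ∧ ∀ n, sv (i - 1) (g ^ n) ≤ C * r ^ n := by
    intro r Q hQ hr
    refine hQ.exists_sv_le hi' ?_
    have h1 := hne r Q hQ
    have h2 : ¬ i < finrank ℝ Q.range := fun h => hr ⟨Q, hQ, h⟩
    omega
  have hbdd : BddAbove S := by
    refine ⟨‖op g‖, fun r hr => ?_⟩
    obtain ⟨c, hc, h⟩ := hS1 r hr
    obtain ⟨Q, hQ, _⟩ := hr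
    refine le_of_forall_pow_le (C := 1) hQ.pos (norm_nonneg _) hc (Eventually.of_forall fun n => ?_)
    refine (h n).trans (sv_le _ hid (Y := ⊤) (by simp) fun x _ => ?_)
    rw [one_mul]
    exact norm_op_pow_le g n x
  have hnonempty : S.Nonempty := by
    have hpos : 0 < ‖op g⁻¹‖⁻¹ := inv_pos.2 (norm_op_pos _)
    obtain ⟨r, Q, hr0, hr1, hQ⟩ := hex 0 _ le_rfl hpos
    refine ⟨r, ?_⟩
    by_contra hrS
    obtain ⟨C', hC', h⟩ := hS2 r Q hQ hrS
    refine absurd (le_of_forall_pow_le (c := 1) (C := C') hpos hr0.le one_pos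
      (Eventually.of_forall fun n => ?_)) (not_le.2 hr1)
    refine le_trans (le_sv _ (X := ⊤) (by simpa using hi') fun x _ => ?_) (h n)
    have h1 := norm_op_pow_le g⁻¹ n (op (g ^ n) x)
    rw [inv_pow, op_inv_apply_self] at h1
    rw [one_mul, inv_pow, inv_mul_le_iff₀ (by have := norm_op_pos g⁻¹; positivity)]
    exact h1
  set r₀ := sSup S with hr₀
  have hr₀pos : 0 < r₀ := by
    obtain ⟨r, hr⟩ := hnonempty
    obtain ⟨Q, hQ, _⟩ := id hr
    exact hQ.pos.trans_le (le_csSup hbdd hr)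
  -- With r > r₀/η in S and r' < r₀η outside S, the ratio r/r' exceeds η⁻², which is larger than θ.
  obtain ⟨η, hη1, hη2⟩ : ∃ η : ℝ, 1 < η ∧ θ * η ^ 2 < 1 := by
    have h1 : Tendsto (fun η : ℝ => θ * η ^ 2) (𝓝[>] 1) (𝓝 (θ * 1 ^ 2)) :=
      Tendsto.mono_left (Continuous.tendsto (by fun_prop) 1) nhdsWithin_le_nhds
    rw [one_pow, mul_one] at h1
    obtain ⟨η, h2, h3⟩ := ((h1.eventually (gt_mem_nhds hθ)).and self_mem_nhdsWithin).exists
    exact ⟨η, h3, h2⟩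
  have hη0 : 0 < η := by linarith
  obtain ⟨r, hr, hrlt⟩ := exists_lt_of_lt_csSup hnonempty (div_lt_self hr₀pos hη1)
  obtain ⟨r', Q', hr'1, hr'2, hQ'⟩ := hex r₀ (r₀ * η) hr₀pos.le (lt_mul_of_one_lt_right hr₀pos hη1)
  have hr'S : r' ∉ S := fun h => absurd (le_csSup hbdd h) (not_le.2 hr'1)
  obtain ⟨c, hc, h1⟩ := hS1 r hr
  obtain ⟨C', hC', h2⟩ := hS2 r' Q' hQ' hr'S
  have hrpos : 0 < r := (div_pos hr₀pos hη0).trans hrlt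
  have hr'pos := hQ'.pos
  have h3 : r ≤ r' * θ := by
    refine le_of_forall_pow_le (c := c) (C := C * C') hrpos (by positivity) hc
      (Eventually.of_forall fun n => ?_)
    have h4 := hg n
    rw [gapRatio, div_le_iff₀ (sv_pos hi' _)] at h4
    have h5 : 0 ≤ C * θ ^ n := (gapRatio_pos hid _).le.trans (hg n)
    calc c * r ^ n ≤ C * θ ^ n * (C' * r' ^ n) :=
          (h1 n).trans (h4.trans (mul_le_mul_of_nonneg_left (h2 n) h5))
      _ = _ := by rw [mul_pow]; ring
  rw [div_lt_iff₀ hη0] at hrlt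
  have h6 : r₀ < r₀ * (θ * η ^ 2) := by
    calc r₀ < r * η := hrlt
      _ ≤ (r' * θ) * η := by gcongr
      _ ≤ (r₀ * η * θ) * η := by gcongr
      _ = _ := by ring
  nlinarith

/-- For u = g^n x in Ξ_i(g^n), the component of u along ker Q is at most C s^n‖x‖, whereas ‖u‖ is at
least c r^n‖x‖; and s < r. -/
theorem tendsto_xiGr_pow (hi : 1 ≤ i) (hid : i < d) {g : GL (Fin d) ℝ} {r : ℝ}
    {Q : EuclideanSpace ℝ (Fin d) →L[ℝ] EuclideanSpace ℝ (Fin d)} (hQ : IsSplitting g r Q)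
    (hg : ∀ᶠ n in atTop, gapRatio i (g ^ n) < 1) (V : Gr d i) (hV : V.1 = Q.range) :
    Tendsto (fun n => xiGr hid (g ^ n)) atTop (𝓝 V) := by
  have hi' : i - 1 < d := by omega
  have hr := hQ.pos
  obtain ⟨c, hc, hcn⟩ := hQ.exists_le_sv (k := i - 1) (by rw [← hV, V.2]; omega)
  obtain ⟨C, s, hC, hs, hsr, hb⟩ := hQ.bounds
  rw [tendsto_gr_iff]
  have hlim : Tendsto (fun n : ℕ => 4 * (C / c * (s / r) ^ n)) atTop (𝓝 0) := by
    simpa using ((tendsto_pow_atTop_nhds_zero_of_lt_one (by positivity)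
      ((div_lt_one hr).2 hsr)).const_mul (C / c)).const_mul 4
  refine squeeze_zero' (Eventually.of_forall fun _ => grDist_nonneg _ _) ?_ hlim
  filter_upwards [hg] with n hn
  rw [grDist_comm]
  refine grDist_le (by positivity) fun u hu => ?_
  rw [xiGr_val hi hid hn] at hu
  obtain ⟨x, rfl⟩ : ∃ x, op (g ^ n) x = u := ⟨_, op_apply_inv_self (g ^ n) u⟩
  refine ⟨Q (op (g ^ n) x), by rw [hV]; exact ⟨_, rfl⟩, ?_⟩
  have h1 := le_norm_of_mem_Xi hi hid hn hu
  rw [← hQ.comm_pow, ← map_sub]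
  have h2 : c * r ^ n * ‖x‖ ≤ ‖op (g ^ n) x‖ :=
    (mul_le_mul_of_nonneg_right (hcn n) (norm_nonneg _)).trans h1
  calc _ ≤ C * s ^ n * ‖x‖ := (hb n x).1
    _ = C / c * (s / r) ^ n * (c * r ^ n * ‖x‖) := by
        rw [div_pow]; field_simp
    _ ≤ _ := by gcongr

theorem isAttractingFixedPoint_of_isSplitting {g : GL (Fin d) ℝ} {r : ℝ}
    {Q : EuclideanSpace ℝ (Fin d) →L[ℝ] EuclideanSpace ℝ (Fin d)} (hQ : IsSplitting g r Q)
    (V : Gr d i) (hV : V.1 = Q.range) : IsAttractingFixedPoint g V := by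
  have hr := hQ.pos
  obtain ⟨C, s, hC, hs, hsr, hb⟩ := hQ.bounds
  have hQV : ∀ v ∈ V.1, Q v = v := by
    rw [hV]
    rintro _ ⟨x, rfl⟩
    exact hQ.idem x
  refine ⟨Subtype.ext (Submodule.eq_of_le_of_finrank_eq ?_ ((Gr.move g V).2.trans V.2.symm)), ?_⟩
  · rintro _ ⟨v, hv, rfl⟩
    rw [hV]
    refine ⟨op g v, ?_⟩
    change Q (op g v) = toEquiv g v
    rw [← hQ.comm, hQV v hv, toEquiv_apply]
  · set R := ContinuousLinearMap.id ℝ (EuclideanSpace ℝ (Fin d)) - Q with hR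
    have hη : 0 < (2 * (‖R‖ + 1))⁻¹ := by positivity
    -- R = 1 - Q kills V, so on this neighborhood ‖w - Qw‖ ≤ ‖w‖/2 for w in W. Thus w keeps a
    -- definite component in the range of Q, which outgrows the other one by (r/s)^n.
    refine ⟨{W | grDist W V < (2 * (‖R‖ + 1))⁻¹}, (nhds_gr_basis V).mem_of_mem hη, fun O hO => ?_⟩
    obtain ⟨ε, hε, hεO⟩ := (nhds_gr_basis V).mem_iff.1 hO
    have hlim : Tendsto (fun n : ℕ => 4 * (2 * C ^ 2 * ‖Q‖ * (s / r) ^ n)) atTop (𝓝 0) := by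
      simpa using ((tendsto_pow_atTop_nhds_zero_of_lt_one (by positivity)
        ((div_lt_one hr).2 hsr)).const_mul (2 * C ^ 2 * ‖Q‖)).const_mul 4
    filter_upwards [hlim.eventually (gt_mem_nhds hε)] with n hn W hW
    refine hεO (lt_of_le_of_lt ?_ hn)
    rw [grDist_comm]
    refine grDist_le (by positivity) ?_
    rintro _ ⟨w, hw, rfl⟩
    have e : (toEquiv (g ^ n)).toLinearMap w = op (g ^ n) w := toEquiv_apply _ _
    rw [e]
    refine ⟨Q (op (g ^ n) w), by rw [hV]; exact ⟨_, rfl⟩, ?_⟩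
    have h1 : ‖w - V.1.starProjection w‖ ≤ (2 * (‖R‖ + 1))⁻¹ * ‖w‖ := by
      have h2 := (W.1.starProjection - V.1.starProjection).le_opNorm w
      rw [_root_.sub_apply, W.1.starProjection_eq_self_iff.2 hw] at h2
      exact h2.trans (mul_le_mul_of_nonneg_right (le_of_lt hW) (norm_nonneg _))
    have h2 : ‖w - Q w‖ ≤ ‖w‖ / 2 := by
      have h3 : w - Q w = R (w - V.1.starProjection w) := by
        rw [hR, _root_.sub_apply, map_sub Q, hQV _ (V.1.starProjection_apply_mem w)]
        simp
      rw [h3]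
      calc _ ≤ ‖R‖ * ((2 * (‖R‖ + 1))⁻¹ * ‖w‖) := (R.le_opNorm _).trans (by gcongr)
        _ ≤ (‖R‖ + 1) * ((2 * (‖R‖ + 1))⁻¹ * ‖w‖) := by gcongr; linarith
        _ = _ := by field_simp
    have h3 : ‖w‖ ≤ 2 * ‖Q w‖ := by
      have := norm_sub_norm_le w (Q w)
      linarith
    have h4 : r ^ n * ‖Q w‖ ≤ C * (‖Q‖ * ‖op (g ^ n) w‖) := by
      refine ((hb n w).2).trans (mul_le_mul_of_nonneg_left ?_ hC.le)
      rw [hQ.comm_pow]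
      exact Q.le_opNorm _
    rw [← hQ.comm_pow, ← map_sub]
    calc _ ≤ C * s ^ n * ‖w‖ := (hb n w).1
      _ ≤ C * s ^ n * (2 * ‖Q w‖) := by gcongr
      _ = 2 * C * (s / r) ^ n * (r ^ n * ‖Q w‖) := by rw [div_pow]; field_simp
      _ ≤ 2 * C * (s / r) ^ n * (C * (‖Q‖ * ‖op (g ^ n) w‖)) := by gcongr
      _ = _ := by ring

/-- If the singular value gap of `g ^ n` grows linearly, the limit of `Ξ_i(g ^ n)` is an
attracting fixed point. -/
theorem isAttractingFixedPoint_of_tendsto_xiGr (hi : 1 ≤ i) (hid : i < d) {g : GL (Fin d) ℝ}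
    {C θ : ℝ} (hθ0 : 0 < θ) (hθ : θ < 1) (hg : ∀ n, gapRatio i (g ^ n) ≤ C * θ ^ n) {V : Gr d i}
    (hV : Tendsto (fun n => xiGr hid (g ^ n)) atTop (𝓝 V)) : IsAttractingFixedPoint g V := by
  obtain ⟨r, Q, hQ, hQi⟩ := exists_isSplitting_finrank_eq hi hid hθ0 hθ hg
  have hlt : ∀ᶠ n in atTop, gapRatio i (g ^ n) < 1 := by
    have : Tendsto (fun n : ℕ => C * θ ^ n) atTop (𝓝 0) := by
      simpa using (tendsto_pow_atTop_nhds_zero_of_lt_one hθ0.le hθ).const_mul C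
    filter_upwards [this.eventually (gt_mem_nhds one_pos)] with n hn using (hg n).trans_lt hn
  obtain rfl := eq_of_tendsto_gr hV (tendsto_xiGr_pow hi hid hQ hlt ⟨Q.range, hQi⟩ rfl)
  exact isAttractingFixedPoint_of_isSplitting hQ _ rfl

end

section

/-! ### Words, word length and the Cayley graph -/

section Words

variable {Λ : Type*} [Semigroup Λ] {F : Finset Λ}

/-- The extension of a semigroup homomorphism into a group to `Λ^e`. -/
def extend {G : Type*} [Group G] (ρ : Λ →ₙ* G) : Unitization Λ →* G :=
  (unitCon Λ).lift (WithOne.lift ρ) (by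
    -- A neutral x satisfies ρ(x)ρ(a) = ρ(a), so cancellation in G gives ρ(x) = 1. The element a is
    -- available unless both related elements are the adjoined identity.
    have key : ∀ (x : WithOne Λ) (a : Λ), IsNeutral x → WithOne.lift ρ x = 1 := by
      intro x a hx
      have h := congrArg (WithOne.lift ρ) (hx a).1
      rw [map_mul] at h
      exact mul_eq_right.1 h
    rintro x y (h | ⟨hx, hy⟩)
    · exact congrArg _ h
    · change WithOne.lift ρ x = WithOne.lift ρ y
      induction x with
      | one =>
        induction y with
        | one => rfl
        | coe a => rw [key _ a hx, key _ a hy]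
      | coe a => rw [key _ a hx, key _ a hy])

@[simp]
theorem extend_incl {G : Type*} [Group G] (ρ : Λ →ₙ* G) (a : Λ) : extend ρ (incl a) = ρ a := rfl

@[simp]
theorem wordVal_nil : wordVal F [] = 1 := rfl

theorem wordVal_cons (a : F) (w : List F) : wordVal F (a :: w) = incl (a : Λ) * wordVal F w := by
  simp [wordVal]

theorem wordVal_append (w w' : List F) : wordVal F (w ++ w') = wordVal F w * wordVal F w' := by
  simp [wordVal]

theorem wordLength_le (w : List F) : wordLength F (wordVal F w) ≤ w.length :=
  Nat.sInf_le ⟨w, rfl, rfl⟩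

theorem exists_word (hF : Generates F) (x : Unitization Λ) :
    ∃ w : List F, w.length = wordLength F x ∧ wordVal F w = x := by
  obtain ⟨w, hw⟩ := hF x
  exact Nat.sInf_mem (s := {n : ℕ | ∃ w : List F, w.length = n ∧ wordVal F w = x}) ⟨_, w, rfl, hw⟩

theorem wordLength_mul_le (hF : Generates F) (x y : Unitization Λ) :
    wordLength F (x * y) ≤ wordLength F x + wordLength F y := by
  obtain ⟨w, hw, rfl⟩ := exists_word hF x
  obtain ⟨w', hw', rfl⟩ := exists_word hF y
  rw [← hw, ← hw', ← wordVal_append, ← List.length_append]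
  exact wordLength_le _

theorem exists_wordLength_le_mul (hF : Generates F) {F' : Finset Λ} (hF' : Generates F') :
    ∃ K : ℕ, ∀ x, wordLength F x ≤ K * wordLength F' x := by
  refine ⟨∑ f ∈ F', wordLength F (incl f), fun x => ?_⟩
  obtain ⟨w, hw, rfl⟩ := exists_word hF' x
  rw [← hw]
  clear hw
  induction w with
  | nil => simpa using wordLength_le (F := F) []
  | cons a w ih =>
    rw [wordVal_cons, List.length_cons, mul_add, mul_one, add_comm]
    refine (wordLength_mul_le hF _ _).trans (add_le_add ?_ ih)
    exact Finset.single_le_sum (f := fun f => wordLength F (incl f)) (fun _ _ => Nat.zero_le _) a.2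

theorem edist_mul_incl_le (x : Unitization Λ) {f : Λ} (hf : f ∈ F) :
    (cayleyGraph F).edist x (x * incl f) ≤ 1 := by
  rw [SimpleGraph.edist_le_one_iff_adj_or_eq]
  by_cases h : x = x * incl f
  · exact Or.inr h
  · exact Or.inl ⟨h, Or.inl ⟨f, hf, rfl⟩⟩

theorem edist_one_wordVal_le (w : List F) (x : Unitization Λ) :
    (cayleyGraph F).edist x (x * wordVal F w) ≤ w.length := by
  induction w generalizing x with
  | nil => simp
  | cons a w ih =>
    rw [wordVal_cons, ← mul_assoc, List.length_cons, Nat.cast_add, Nat.cast_one, add_comm]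
    exact (SimpleGraph.edist_triangle (v := x * incl (a : Λ))).trans
      (add_le_add (edist_mul_incl_le x a.2) (ih _))

/-- Edges are right multiplications, so left multiplication carries each edge to an edge or
collapses it to a point. -/
theorem edist_mul_left_le (z x y : Unitization Λ) :
    (cayleyGraph F).edist (z * x) (z * y) ≤ (cayleyGraph F).edist x y := by
  have key : ∀ {x y : Unitization Λ} (p : (cayleyGraph F).Walk x y),
      (cayleyGraph F).edist (z * x) (z * y) ≤ p.length := by
    intro x y p
    induction p with
    | nil => simp
    | cons hadj p ih =>
      rw [SimpleGraph.Walk.length_cons, Nat.cast_add, Nat.cast_one, add_comm]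
      refine (SimpleGraph.edist_triangle).trans (add_le_add ?_ ih)
      obtain ⟨_, ⟨f, hf, rfl⟩ | ⟨f, hf, rfl⟩⟩ := hadj
      · rw [← mul_assoc]; exact edist_mul_incl_le _ hf
      · rw [← mul_assoc, SimpleGraph.edist_comm]; exact edist_mul_incl_le _ hf
  by_cases h : (cayleyGraph F).edist x y = ⊤
  · rw [h]; exact le_top
  · obtain ⟨p, hp⟩ := SimpleGraph.exists_walk_of_edist_ne_top h
    rw [← hp]; exact key p

end Words

/-! ### Segments of sequences -/

section Prepend

variable {Λ : Type*} {F : Finset Λ}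

theorem prepend_nil (f : ℕ → F) : prepend [] f = f := by
  ext n; simp [prepend]

theorem prepend_cons_succ (a : F) (w : List F) (f : ℕ → F) (n : ℕ) :
    prepend (a :: w) f (n + 1) = prepend w f n := by
  simp [prepend]

theorem prepend_append (w w' : List F) (f : ℕ → F) :
    prepend (w ++ w') f = prepend w (prepend w' f) := by
  induction w with
  | nil => rw [prepend_nil, List.nil_append]
  | cons a w ih =>
    funext n
    cases n with
    | zero => rfl
    | succ n => rw [List.cons_append, prepend_cons_succ, prepend_cons_succ, ih]

end Prepend

section Segments

variable {Λ : Type*} [Semigroup Λ] {F : Finset Λ}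

theorem seg_succ_left (f : ℕ → F) (k l : ℕ) : seg f (k + 1) l = seg (fun n => f (n + 1)) k l := by
  induction l with
  | zero => rfl
  | succ l ih =>
    rw [seg, seg, ih, show k + 1 + (l + 1) = k + (l + 1) + 1 by ring]

theorem seg_zero_succ (f : ℕ → F) (l : ℕ) :
    seg f 0 (l + 1) = (f 0 : Λ) * seg (fun n => f (n + 1)) 0 l := by
  induction l with
  | zero => rfl
  | succ l ih =>
    rw [seg, ih, seg, mul_assoc]
    simp only [zero_add]

theorem exists_word_seg (f : ℕ → F) (k l : ℕ) :
    ∃ w : List F, w.length = l + 1 ∧ wordVal F w = incl (seg f k l) := by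
  induction l with
  | zero => exact ⟨[f k], rfl, by simp [wordVal, seg]⟩
  | succ l ih =>
    obtain ⟨w, hw, hw'⟩ := ih
    exact ⟨w ++ [f (k + (l + 1))], by simp [hw],
      by rw [wordVal_append, hw', seg, incl_mul]; simp [wordVal]⟩

theorem edist_one_seg_le (f : ℕ → F) (k l : ℕ) :
    (cayleyGraph F).edist 1 (incl (seg f k l)) ≤ (l + 1 : ℕ) := by
  obtain ⟨w, hw, hw'⟩ := exists_word_seg f k l
  rw [← hw, ← hw']
  simpa using edist_one_wordVal_le w 1

theorem incl_seg_prepend (w : List F) (f : ℕ → F) (n : ℕ) :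
    incl (seg (prepend w f) 0 (n + w.length)) = wordVal F w * incl (seg f 0 n) := by
  induction w with
  | nil => simp [prepend_nil]
  | cons a w ih =>
    rw [List.length_cons, ← add_assoc, seg_zero_succ, incl_mul]
    simp only [prepend_cons_succ]
    change _ * incl (seg (prepend w f) 0 _) = _
    rw [ih, wordVal_cons, mul_assoc]
    rfl

theorem StaysWithin.mono {M N : ℕ} (hMN : M ≤ N) {f g : ℕ → F} (h : StaysWithin M f g) :
    StaysWithin N f g := fun n => by
  obtain ⟨m, hm⟩ := h n
  exact ⟨m, hm.trans (by exact_mod_cast hMN)⟩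

theorem StaysWithin.prepend {N : ℕ} {f g : ℕ → F} (h : StaysWithin N f g) (w : List F) :
    StaysWithin N (prepend w f) (prepend w g) := by
  induction w with
  | nil => simpa only [prepend_nil] using h
  | cons a w ih =>
    intro n
    cases n with
    | zero => exact ⟨0, by simp [seg, AnosovSemigroup.prepend]⟩
    | succ n =>
      obtain ⟨m, hm⟩ := ih n
      refine ⟨m + 1, ?_⟩
      rw [seg_zero_succ, seg_zero_succ, incl_mul, incl_mul]
      refine (edist_mul_left_le _ _ _).trans ?_
      simp only [prepend_cons_succ]
      exact hm

theorem staysWithin_prepend_of_wordVal_eq {w w' : List F} (h : wordVal F w = wordVal F w')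
    (f : ℕ → F) : StaysWithin (w.length + 2) (prepend w f) (prepend w' f) := by
  intro n
  rcases le_or_gt w.length n with hn | hn
  · obtain ⟨m, rfl⟩ := Nat.exists_eq_add_of_le' hn
    refine ⟨m + w'.length, ?_⟩
    rw [incl_seg_prepend, incl_seg_prepend, h]
    simp
  -- Inside the prefix, go back to the identity in at most n + 1 ≤ `w.length` steps and then one
  -- step to the first vertex of the other path.
  · refine ⟨0, ?_⟩
    have h1 := edist_one_seg_le (prepend w f) 0 n
    have h2 := edist_one_seg_le (prepend w' f) 0 0
    rw [SimpleGraph.edist_comm] at h1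
    refine (SimpleGraph.edist_triangle (v := 1)).trans ((add_le_add h1 h2).trans ?_)
    exact_mod_cast (by omega : n + 1 + (0 + 1) ≤ w.length + 2)

theorem prepend_equiv {w w' : List F} (h : wordVal F w = wordVal F w') (f : ℕ → F) :
    ∃ N, StaysWithin N (prepend w f) (prepend w' f) ∧ StaysWithin N (prepend w' f) (prepend w f) :=
  ⟨_, (staysWithin_prepend_of_wordVal_eq h f).mono (le_max_left _ (w'.length + 2)),
    (staysWithin_prepend_of_wordVal_eq h.symm f).mono (le_max_right _ _)⟩

end Segments

/-! ### Uniform gap estimates -/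

section Bounds

variable {Λ : Type*} [Semigroup Λ] {F : Finset Λ} {d i : ℕ} {ρ : Λ →ₙ* GL (Fin d) ℝ}

/-- Constants controlling the generators and the singular value gap of `ρ` with respect to `F`. -/
structure GapBounds (F : Finset Λ) (i : ℕ) (ρ : Λ →ₙ* GL (Fin d) ℝ) (L A c : ℝ) : Prop where
  c_pos : 0 < c
  c_le : c ≤ L
  A_nonneg : 0 ≤ A
  cond_le : ∀ f ∈ F, cond (ρ f) ≤ Real.exp L
  gap_le : ∀ γ, gapRatio i (ρ γ) ≤ Real.exp (A - c * (wordLength F (incl γ) : ℝ))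

theorem IsAnosov.exists_gapBounds (hid : i < d) (hρ : IsAnosov i ρ) (hF : Generates F) :
    ∃ L A c, GapBounds F i ρ L A c := by
  obtain ⟨F', hF', c, c', hc, hc', h⟩ := hρ
  obtain ⟨K, hK⟩ := exists_wordLength_le_mul hF hF'
  have hS : 0 ≤ ∑ f ∈ F, cond (ρ f) := Finset.sum_nonneg fun _ _ => cond_nonneg _
  -- The first summand of L ensures c ≤ L; `K + 1` avoids dividing by zero, and the 1 inside the
  -- logarithm keeps it nonnegative.
  refine ⟨c / (K + 1) + Real.log (1 + ∑ f ∈ F, cond (ρ f)), c', c / (K + 1), by positivity, ?_,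
    hc'.le, fun f hf => ?_, fun γ => ?_⟩
  · have := Real.log_nonneg (show 1 ≤ 1 + ∑ f ∈ F, cond (ρ f) by linarith)
    linarith
  · rw [Real.exp_add, Real.exp_log (by linarith)]
    have h1 := Finset.single_le_sum (f := fun f => cond (ρ f)) (fun _ _ => cond_nonneg _) hf
    have h2 : 1 ≤ Real.exp (c / (K + 1)) := Real.one_le_exp (by positivity)
    nlinarith
  · rw [gapRatio_eq_exp hid, Real.exp_le_exp]
    have h1 := h γ
    have h2 : (wordLength F (incl γ) : ℝ) ≤ (K + 1) * wordLength F' (incl γ) := by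
      have : (wordLength F (incl γ) : ℝ) ≤ K * wordLength F' (incl γ) := by
        exact_mod_cast hK (incl γ)
      have h3 : (0 : ℝ) ≤ wordLength F' (incl γ) := Nat.cast_nonneg _
      linarith
    have h4 : c / (K + 1) * (wordLength F (incl γ) : ℝ) ≤ c * wordLength F' (incl γ) := by
      calc _ ≤ c / (K + 1) * ((K + 1) * wordLength F' (incl γ)) := by gcongr
        _ = _ := by field_simp
    linarith

namespace GapBounds

variable {L A c : ℝ}

theorem L_pos (hb : GapBounds F i ρ L A c) : 0 < L := hb.c_pos.trans_le hb.c_le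

theorem exists_cond_le_of_edist (hb : GapBounds F i ρ L A c) {x y : Unitization Λ} {N : ℕ}
    (h : (cayleyGraph F).edist x y ≤ N) :
    ∃ g, extend ρ y = extend ρ x * g ∧ cond g ≤ Real.exp L ^ N := by
  have key : ∀ {x y : Unitization Λ} (p : (cayleyGraph F).Walk x y),
      ∃ g, extend ρ y = extend ρ x * g ∧ cond g ≤ Real.exp L ^ p.length := by
    intro x y p
    induction p with
    | nil => exact ⟨1, by simp, by simpa using cond_one_le⟩
    | @cons u v w hadj p ih =>
      obtain ⟨g, hg, hg'⟩ := ih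
      have h1 : ∃ k, extend ρ v = extend ρ u * k ∧ cond k ≤ Real.exp L := by
        obtain ⟨_, ⟨f, hf, rfl⟩ | ⟨f, hf, rfl⟩⟩ := hadj
        · exact ⟨ρ f, by simp, hb.cond_le f hf⟩
        · exact ⟨(ρ f)⁻¹, by simp, (cond_inv _).trans_le (hb.cond_le f hf)⟩
      obtain ⟨k, hk, hk'⟩ := h1
      refine ⟨k * g, by rw [hg, hk, mul_assoc], (cond_mul_le _ _).trans ?_⟩
      rw [SimpleGraph.Walk.length_cons, pow_succ']
      exact mul_le_mul hk' hg' (cond_nonneg _) (Real.exp_pos _).le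
  obtain ⟨p, hp⟩ := SimpleGraph.exists_walk_of_edist_ne_top
    (ne_top_of_le_ne_top (ENat.natCast_ne_top N) h)
  obtain ⟨g, hg, hg'⟩ := key p
  refine ⟨g, hg, hg'.trans (pow_le_pow_right₀ (Real.one_le_exp hb.L_pos.le) ?_)⟩
  rw [← hp] at h
  exact_mod_cast h

/-- The converse of the Anosov inequality: each letter changes the ratio by a factor at most exp L,
starting from the value 1 at the identity. -/
theorem one_le_pow_mul_gapRatio (hb : GapBounds F i ρ L A c) (hid : i < d) (w : List F) :
    1 ≤ Real.exp L ^ w.length * gapRatio i (extend ρ (wordVal F w)) := by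
  have h1 := edist_one_wordVal_le w 1
  rw [one_mul, SimpleGraph.edist_comm] at h1
  obtain ⟨g, hg, hg'⟩ := hb.exists_cond_le_of_edist h1
  rw [map_one] at hg
  have h2 := gapRatio_mul_right_le hid (extend ρ (wordVal F w)) g
  rw [← hg, gapRatio_one hid] at h2
  exact h2.trans (mul_le_mul_of_nonneg_right hg' (gapRatio_pos hid _).le)

/-- Left multiplication by a generator does not shrink word length by more than a bounded
factor. -/
theorem le_wordLength_mul (hb : GapBounds F i ρ L A c) (hid : i < d) (hF : Generates F)
    {a : Λ} (ha : a ∈ F) (x : Λ) :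
    c / L * (wordLength F (incl x) : ℝ) - (1 + A / L) ≤ wordLength F (incl (a * x)) := by
  have hL := hb.L_pos
  -- A shortest word for ax bounds the gap ratio of ρ(ax) below in terms of |ax|; the gap of ρ(x)
  -- bounds it above in terms of |x|.
  obtain ⟨w, hw, hw'⟩ := exists_word hF (incl (a * x))
  have h1 := hb.one_le_pow_mul_gapRatio hid w
  rw [hw', extend_incl, hw, map_mul] at h1
  have h2 := gapRatio_mul_left_le hid (ρ x) (ρ a)
  have h3 : (1 : ℝ) ≤ Real.exp L ^ wordLength F (incl (a * x)) *
      (Real.exp L * Real.exp (A - c * (wordLength F (incl x) : ℝ))) := by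
    refine h1.trans (mul_le_mul_of_nonneg_left (h2.trans ?_) (by positivity))
    exact mul_le_mul (hb.cond_le a ha) (hb.gap_le x) (gapRatio_pos hid _).le (Real.exp_pos _).le
  rw [← Real.exp_nat_mul, ← Real.exp_add, ← Real.exp_add, Real.one_le_exp_iff] at h3
  rw [← mul_le_mul_iff_of_pos_left hL]
  have e : L * (c / L * (wordLength F (incl x) : ℝ) - (1 + A / L)) =
      c * wordLength F (incl x) - L - A := by field_simp; ring
  rw [e]
  linarith

theorem exists_isQG_of_tail (hb : GapBounds F i ρ L A c) (hid : i < d) (hF : Generates F)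
    (f : ℕ → F) (h : ∃ κ κ' : ℝ, 0 < κ ∧ κ ≤ 1 ∧ 0 ≤ κ' ∧ IsQG κ κ' fun n => f (n + 1)) :
    ∃ κ κ' : ℝ, 0 < κ ∧ κ ≤ 1 ∧ 0 ≤ κ' ∧ IsQG κ κ' f := by
  obtain ⟨κ, κ', hκ, hκ1, hκ', hQG⟩ := h
  have hL := hb.L_pos
  have hc := hb.c_pos
  have hA := hb.A_nonneg
  have hα : c / L ≤ 1 := (div_le_one hL).2 hb.c_le
  have hα0 : 0 < c / L := by positivity
  have hAL : 0 ≤ A / L := by positivity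
  have hακ : c / L * κ ≤ κ := mul_le_of_le_one_left hκ.le hα
  -- Only segments starting at 0 lose anything: 1 + A/L comes from `le_wordLength_mul`, and the
  -- remaining 1 pays for the additional letter, as (c/L)κ ≤ 1.
  refine ⟨c / L * κ, κ' + 2 + A / L, by positivity, hακ.trans hκ1, by positivity, fun k l => ?_⟩
  have hl : (0 : ℝ) ≤ l := Nat.cast_nonneg l
  rcases k with _ | k
  · rcases l with _ | l
    · have h0 : (0 : ℝ) ≤ wordLength F (incl (seg f 0 0)) := Nat.cast_nonneg _
      push_cast
      linarith
    · have h1 := hQG 0 l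
      have h2 := hb.le_wordLength_mul hid hF (f 0).2 (seg (fun n => f (n + 1)) 0 l)
      rw [seg_zero_succ]
      have h3 := mul_le_mul_of_nonneg_left h1 hα0.le
      have h4 : c / L * κ' ≤ κ' := mul_le_of_le_one_left hκ' hα
      push_cast
      rw [mul_sub, ← mul_assoc] at h3
      linarith
  · rw [seg_succ_left]
    refine le_trans ?_ (hQG k l)
    have := mul_le_mul_of_nonneg_right hακ (show (0 : ℝ) ≤ l + 1 by positivity)
    linarith

theorem exists_prepend (hb : GapBounds F i ρ L A c) (hid : i < d) (hF : Generates F)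
    (w : List F) (f : QG F) : ∃ g : QG F, g.1 = prepend w f.1 := by
  suffices h : ∃ κ κ' : ℝ, 0 < κ ∧ κ ≤ 1 ∧ 0 ≤ κ' ∧ IsQG κ κ' (prepend w f.1) from ⟨⟨_, h⟩, rfl⟩
  induction w with
  | nil => rw [prepend_nil]; exact f.2
  | cons a w ih =>
    refine hb.exists_isQG_of_tail hid hF _ ?_
    simp only [prepend_cons_succ]
    exact ih

theorem gapRatio_seg_le (hb : GapBounds F i ρ L A c) {κ κ' : ℝ} (hκ : 0 < κ) {f : ℕ → F}
    (hf : IsQG κ κ' f) (n : ℕ) :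
    gapRatio i (ρ (seg f 0 n)) ≤ Real.exp (A + c * κ') * Real.exp (-(c * κ)) ^ n := by
  refine (hb.gap_le _).trans ?_
  rw [← Real.exp_nat_mul, ← Real.exp_add, Real.exp_le_exp]
  have h1 := mul_le_mul_of_nonneg_left (hf 0 n) hb.c_pos.le
  have h2 := mul_pos hb.c_pos hκ
  linarith

theorem exp_neg_lt_one (hb : GapBounds F i ρ L A c) {κ : ℝ} (hκ : 0 < κ) :
    Real.exp (-(c * κ)) < 1 := by
  rw [Real.exp_lt_one_iff]
  have := mul_pos hb.c_pos hκ
  linarith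

theorem tendsto_gapRatio_seg (hb : GapBounds F i ρ L A c) (hid : i < d) (f : QG F) :
    Tendsto (fun n => gapRatio i (ρ (seg f.1 0 n))) atTop (𝓝 0) := by
  obtain ⟨κ, κ', hκ, _, _, hf⟩ := f.2
  refine squeeze_zero (fun n => (gapRatio_pos hid _).le) (hb.gapRatio_seg_le hκ hf) ?_
  simpa using (tendsto_pow_atTop_nhds_zero_of_lt_one (Real.exp_pos _).le
    (hb.exp_neg_lt_one hκ)).const_mul (Real.exp (A + c * κ'))

/-- Along quasigeodesics with given constants, `Ξ_i` converges at a uniform exponential rate. -/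
theorem exists_tendsto_xiGr_seg (hb : GapBounds F i ρ L A c) (hi : 1 ≤ i) (hid : i < d) {κ : ℝ}
    (hκ : 0 < κ) (κ' : ℝ) : ∃ C θ : ℝ, 0 ≤ θ ∧ θ < 1 ∧ ∀ f : ℕ → F, IsQG κ κ' f →
      ∃ V : Gr d i, Tendsto (fun n => xiGr hid (ρ (seg f 0 n))) atTop (𝓝 V) ∧
        ∀ n, grDist (xiGr hid (ρ (seg f 0 n))) V ≤ C * θ ^ n := by
  set θ := Real.exp (-(c * κ)) with hθ
  have hθ1 : θ < 1 := hb.exp_neg_lt_one hκ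
  refine ⟨4 * (Real.exp L * Real.exp (A + c * κ')) / (1 - θ), θ, (Real.exp_pos _).le, hθ1,
    fun f hf => ?_⟩
  have h : ∀ n, grDist (xiGr hid (ρ (seg f 0 n))) (xiGr hid (ρ (seg f 0 (n + 1)))) ≤
      4 * (Real.exp L * Real.exp (A + c * κ')) * θ ^ n := by
    intro n
    rw [seg, map_mul]
    refine (grDist_xiGr_mul_right hi hid _ _).trans ?_
    rw [mul_assoc, mul_assoc]
    refine mul_le_mul_of_nonneg_left ?_ (by norm_num)
    exact mul_le_mul (hb.cond_le _ (f _).2) (hb.gapRatio_seg_le hκ hf n) (gapRatio_pos hid _).le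
      (Real.exp_pos _).le
  obtain ⟨V, hV, hV'⟩ := exists_tendsto_gr_of_geometric hθ1 h
  exact ⟨V, hV, fun n => (hV' n).trans (le_of_eq (by ring))⟩

end GapBounds

theorem tendsto_of_grDist_tendsto_zero {α : Type*} {l : Filter α} {W W' : α → Gr d i} {V : Gr d i}
    (h : Tendsto W l (𝓝 V)) (h' : Tendsto (fun a => grDist (W' a) (W a)) l (𝓝 0)) :
    Tendsto W' l (𝓝 V) := by
  rw [tendsto_gr_iff] at h ⊢
  have := h'.add h
  rw [add_zero] at this
  exact squeeze_zero (fun _ => grDist_nonneg _ _) (fun _ => grDist_triangle _ _ _) this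

theorem tendsto_xiGr_of_bounded_mul (hi : 1 ≤ i) (hid : i < d) {α : Type*} {l : Filter α}
    {x y : α → GL (Fin d) ℝ} {K : ℝ} (hxy : ∀ a, ∃ h, y a = x a * h ∧ cond h ≤ K)
    (hx : Tendsto (fun a => gapRatio i (x a)) l (𝓝 0)) {V : Gr d i}
    (hV : Tendsto (fun a => xiGr hid (x a)) l (𝓝 V)) :
    Tendsto (fun a => gapRatio i (y a)) l (𝓝 0) ∧ Tendsto (fun a => xiGr hid (y a)) l (𝓝 V) := by
  have hlim : Tendsto (fun a => K * gapRatio i (x a)) l (𝓝 0) := by simpa using hx.const_mul K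
  have hlim' : Tendsto (fun a => 4 * (K * gapRatio i (x a))) l (𝓝 0) := by
    simpa using hlim.const_mul 4
  constructor
  · refine squeeze_zero (fun a => (gapRatio_pos hid _).le) (fun a => ?_) hlim
    obtain ⟨h, hy, hK⟩ := hxy a
    rw [hy]
    exact (gapRatio_mul_right_le hid _ _).trans
      (mul_le_mul_of_nonneg_right hK (gapRatio_pos hid _).le)
  · refine tendsto_of_grDist_tendsto_zero hV (squeeze_zero (fun a => grDist_nonneg _ _) (fun a => ?_) hlim')
    obtain ⟨h, hy, hK⟩ := hxy a
    rw [hy, grDist_comm]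
    exact (grDist_xiGr_mul_right hi hid _ _).trans (mul_le_mul_of_nonneg_left
      (mul_le_mul_of_nonneg_right hK (gapRatio_pos hid _).le) (by norm_num))

end Bounds

end

/-! ### The boundary map -/

section Boundary

variable {Λ : Type*} [Semigroup Λ] {F : Finset Λ} {d i : ℕ} {ρ : Λ →ₙ* GL (Fin d) ℝ}

namespace GapBounds

variable {L A c : ℝ}

theorem xiTendsto_seg (hb : GapBounds F i ρ L A c) (hi : 1 ≤ i) (hid : i < d) (f : QG F)
    {V : Gr d i} (hV : Tendsto (fun n => xiGr hid (ρ (seg f.1 0 n))) atTop (𝓝 V)) :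
    XiTendsto (fun n => ρ (seg f.1 0 n)) V := by
  have h := (hb.tendsto_gapRatio_seg hid f).eventually (gt_mem_nhds one_pos)
  exact ⟨h.mono fun n hn => (mu_lt_iff hid _).2 hn, _, h.mono fun n hn => xiGr_val hi hid hn, hV⟩

/-- On each QG^{κ,κ'} the map is a uniform limit of maps that depend on finitely many letters only,
hence are locally constant. -/
theorem continuous_of_tendsto_xiGr (hb : GapBounds F i ρ L A c) (hi : 1 ≤ i) (hid : i < d)
    {E : QG F → Gr d i}
    (hE : ∀ f : QG F, Tendsto (fun n => xiGr hid (ρ (seg f.1 0 n))) atTop (𝓝 (E f))) :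
    Continuous E := by
  refine continuous_iSup_dom.2 fun κ => continuous_iSup_dom.2 fun κ' =>
    continuous_coinduced_dom.2 ?_
  obtain ⟨C, θ, hθ0, hθ1, h⟩ := hb.exists_tendsto_xiGr_seg hi hid κ.2.1 κ'
  have hEb : ∀ (f : QGConst F κ κ') (n : ℕ),
      grDist (xiGr hid (ρ (seg f.1 0 n))) (E (f.toQG κ κ')) ≤ C * θ ^ n := by
    intro f n
    obtain ⟨V, hV, hV'⟩ := h f.1 f.2
    rw [eq_of_tendsto_gr (hE (f.toQG κ κ')) hV]
    exact hV' n
  refine continuous_iff_continuousAt.2 fun f => ?_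
  refine (nhds_gr_basis _).tendsto_right_iff.2 fun ε hε => ?_
  have hlim : Tendsto (fun n : ℕ => C * θ ^ n + C * θ ^ n) atTop (𝓝 0) := by
    have h0 : Tendsto (fun n : ℕ => C * θ ^ n) atTop (𝓝 0) := by
      simpa using (tendsto_pow_atTop_nhds_zero_of_lt_one hθ0 hθ1).const_mul C
    simpa using h0.add h0
  obtain ⟨n, hn⟩ := (hlim.eventually (gt_mem_nhds hε)).exists
  have hnear : ∀ᶠ f' : QGConst F κ κ' in 𝓝 f, ∀ j ∈ Finset.range (n + 1), f'.1 j = f.1 j := by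
    rw [Filter.eventually_all_finset]
    intro j _
    let _ : TopologicalSpace F := ⊥
    have : DiscreteTopology F := ⟨rfl⟩
    have hcont : Continuous fun f' : QGConst F κ κ' => f'.1 j :=
      (continuous_apply j).comp continuous_induced_dom
    exact hcont.continuousAt.eventually (show ∀ᶠ a in 𝓝 (f.1 j), a = f.1 j by simp [nhds_discrete])
  filter_upwards [hnear] with f' hf'
  have hseg : ∀ m, m ≤ n → seg f'.1 0 m = seg f.1 0 m := by
    intro m
    induction m with
    | zero => intro _; exact congrArg Subtype.val (hf' 0 (by simp))
    | succ m ih =>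
      intro hm
      rw [seg, seg, ih (by omega), hf' (0 + (m + 1)) (by simp; omega)]
  have h1 := hEb f n
  have h2 := hEb f' n
  rw [hseg n le_rfl, grDist_comm] at h2
  exact (grDist_triangle _ _ _).trans_lt ((add_le_add h2 h1).trans_lt hn)

/-- Words of bounded length have gap ratio bounded away from 0. -/
theorem tendsto_atTop_of_gapRatio (hb : GapBounds F i ρ L A c) (hid : i < d) (f : ℕ → F)
    {m : ℕ → ℕ} (h : Tendsto (fun n => gapRatio i (ρ (seg f 0 (m n)))) atTop (𝓝 0)) :
    Tendsto m atTop atTop := by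
  refine tendsto_atTop.2 fun M => ?_
  have hpos : 0 < (Real.exp L ^ (M + 1))⁻¹ := by positivity
  filter_upwards [h.eventually (gt_mem_nhds hpos)] with n hn
  by_contra! hlt
  obtain ⟨w, hw, hw'⟩ := exists_word_seg f 0 (m n)
  have h1 := hb.one_le_pow_mul_gapRatio hid w
  rw [hw', extend_incl, hw] at h1
  have h2 : Real.exp L ^ (m n + 1) ≤ Real.exp L ^ (M + 1) :=
    pow_le_pow_right₀ (Real.one_le_exp hb.L_pos.le) (by omega)
  have h3 : Real.exp L ^ (m n + 1) * gapRatio i (ρ (seg f 0 (m n))) < 1 := by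
    calc _ < Real.exp L ^ (m n + 1) * (Real.exp L ^ (M + 1))⁻¹ := by gcongr
      _ ≤ Real.exp L ^ (M + 1) * (Real.exp L ^ (M + 1))⁻¹ := by gcongr
      _ = 1 := mul_inv_cancel₀ (by positivity)
  linarith

/-- The vertices of g chosen near those of f differ from them by bounded right factors, so they
inherit the limit V. Their gap ratios tend to 0, which forces the chosen indices to infinity, so
they also see the limit W. -/
theorem limit_eq_of_staysWithin (hb : GapBounds F i ρ L A c) (hi : 1 ≤ i) (hid : i < d)
    {f g : QG F} {N : ℕ} (h : StaysWithin N f.1 g.1) {V W : Gr d i}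
    (hV : Tendsto (fun n => xiGr hid (ρ (seg f.1 0 n))) atTop (𝓝 V))
    (hW : Tendsto (fun n => xiGr hid (ρ (seg g.1 0 n))) atTop (𝓝 W)) : V = W := by
  choose m hm using h
  obtain ⟨h1, h2⟩ := tendsto_xiGr_of_bounded_mul hi hid (x := fun n => ρ (seg f.1 0 n))
    (y := fun n => ρ (seg g.1 0 (m n))) (K := Real.exp L ^ N)
    (fun n => hb.exists_cond_le_of_edist (hm n)) (hb.tendsto_gapRatio_seg hid f) hV
  exact eq_of_tendsto_gr h2 (hW.comp (hb.tendsto_atTop_of_gapRatio hid g.1 h1))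

theorem limit_prepend (hb : GapBounds F i ρ L A c) (hi : 1 ≤ i) (hid : i < d) {γ : Λ} {w : List F}
    (hw : wordVal F w = incl γ) {f g : QG F} (hg : g.1 = prepend w f.1) {V W : Gr d i}
    (hV : Tendsto (fun n => xiGr hid (ρ (seg f.1 0 n))) atTop (𝓝 V))
    (hW : Tendsto (fun n => xiGr hid (ρ (seg g.1 0 n))) atTop (𝓝 W)) : W = Gr.move (ρ γ) V := by
  have h1 : ∀ n, ρ (seg g.1 0 (n + w.length)) = ρ γ * ρ (seg f.1 0 n) := by
    intro n
    rw [← extend_incl, hg, incl_seg_prepend, hw, map_mul, extend_incl, extend_incl]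
  have h2 := hW.comp (tendsto_add_atTop_nat w.length)
  refine eq_of_tendsto_gr h2 (tendsto_of_grDist_tendsto_zero (tendsto_move (ρ γ) hV) ?_)
  have hlim : Tendsto (fun n => 4 * (cond (ρ γ) * gapRatio i (ρ (seg f.1 0 n)))) atTop (𝓝 0) := by
    simpa using ((hb.tendsto_gapRatio_seg hid f).const_mul (cond (ρ γ))).const_mul 4
  refine squeeze_zero (fun _ => grDist_nonneg _ _) (fun n => ?_) hlim
  simp only [Function.comp_apply, h1]
  exact grDist_xiGr_mul_left hi hid _ _

theorem isAttractingFixedPoint_limit (hb : GapBounds F i ρ L A c) (hi : 1 ≤ i) (hid : i < d)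
    {γ : Λ} {f : QG F} {φ : ℕ+ → ℕ+} {N : ℕ} (hφ : StrictMono φ)
    (h : ∀ n : ℕ+, (cayleyGraph F).edist (incl γ ^ (n : ℕ))
      (incl (seg f.1 0 ((φ n : ℕ) - 1))) ≤ N) {V : Gr d i}
    (hV : Tendsto (fun n => xiGr hid (ρ (seg f.1 0 n))) atTop (𝓝 V)) :
    IsAttractingFixedPoint (ρ γ) V := by
  -- The index shift turns positive integers into naturals: γ^(n+1) is near the segment that ends at
  -- letter `m n`.
  let m : ℕ → ℕ := fun n => (φ n.succPNat : ℕ) - 1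
  have hm : ∀ n, n ≤ m n := by
    intro n
    have h1 : n.succPNat ≤ φ n.succPNat := hφ.le_apply
    have h2 : ((n.succPNat : ℕ+) : ℕ) ≤ (φ n.succPNat : ℕ) := h1
    rw [Nat.succPNat_coe] at h2
    change n ≤ (φ n.succPNat : ℕ) - 1
    omega
  have hmt : Tendsto m atTop atTop := tendsto_atTop_mono hm tendsto_id
  have hxy : ∀ n, ∃ h, ρ γ ^ (n + 1) = ρ (seg f.1 0 (m n)) * h ∧ cond h ≤ Real.exp L ^ N := by
    intro n
    have h1 := h n.succPNat
    rw [SimpleGraph.edist_comm] at h1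
    obtain ⟨k, hk, hk'⟩ := hb.exists_cond_le_of_edist h1
    rw [map_pow, extend_incl, extend_incl] at hk
    exact ⟨k, hk, hk'⟩
  obtain ⟨-, h2⟩ := tendsto_xiGr_of_bounded_mul hi hid hxy
    ((hb.tendsto_gapRatio_seg hid f).comp hmt) (hV.comp hmt)
  obtain ⟨κ, κ', hκ, _, _, hf⟩ := f.2
  set θ := Real.exp (-(c * κ)) with hθ
  have hθ0 : 0 < θ := Real.exp_pos _
  have hθ1 : θ < 1 := hb.exp_neg_lt_one hκ
  set C := Real.exp L ^ N * Real.exp (A + c * κ') with hC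
  have hC0 : 0 < C := by positivity
  -- In the constant, 1 handles n = 0 and the division by θ undoes the shift from n to n + 1.
  refine isAttractingFixedPoint_of_tendsto_xiGr hi hid (C := 1 + C / θ) hθ0 hθ1 (fun n => ?_)
    ((tendsto_add_atTop_iff_nat 1).1 h2)
  rcases n with _ | n
  · rw [pow_zero, gapRatio_one hid, pow_zero, mul_one]
    have : 0 < C / θ := by positivity
    linarith
  · obtain ⟨k, hk, hk'⟩ := hxy n
    have h3 := hb.gapRatio_seg_le hκ hf (m n)
    have h4 : θ ^ m n ≤ θ ^ n := pow_le_pow_of_le_one hθ0.le hθ1.le (hm n)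
    rw [hk]
    calc _ ≤ Real.exp L ^ N * (Real.exp (A + c * κ') * θ ^ n) := by
          refine (gapRatio_mul_right_le hid _ _).trans (mul_le_mul hk' (h3.trans ?_)
            (gapRatio_pos hid _).le (by positivity))
          gcongr
      _ = C / θ * θ ^ (n + 1) := by rw [hC, pow_succ]; field_simp
      _ ≤ _ := by gcongr; linarith

end GapBounds

/-- Each γ acts by prepending one chosen word. Any other word with the same value gives an
equivalent sequence, because the two paths agree up to a shift of index after the prefixes;
compatibility with products follows by concatenating words. -/
theorem exists_isNaturalAction (hF : Generates F) {pre : List F → QG F → QG F}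
    (hpre : ∀ w f, (pre w f).1 = prepend w f.1) :
    ∃ act : Λ → Boundary F → Boundary F, IsNaturalAction act := by
  choose word hword using fun γ : Λ => hF (incl γ)
  have hmap : ∀ γ (f g : QG F), (qgSetoid F).r f g → (qgSetoid F).r (pre (word γ) f) (pre (word γ) g) := by
    rintro γ f g ⟨N, h, h'⟩
    refine ⟨N, ?_, ?_⟩ <;> rw [hpre, hpre]
    exacts [h.prepend _, h'.prepend _]
  have hrel : ∀ (w w' : List F) (f : QG F) (g g' : QG F), wordVal F w = wordVal F w' →
      g.1 = prepend w f.1 → g'.1 = prepend w' f.1 → endpoint g = endpoint g' := by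
    intro w w' f g g' hw hg hg'
    obtain ⟨N, h, h'⟩ := prepend_equiv hw f.1
    refine Quotient.sound ⟨N, ?_, ?_⟩ <;> rw [hg, hg']
    exacts [h, h']
  refine ⟨fun γ => Quotient.map' (s₁ := qgSetoid F) (s₂ := qgSetoid F) (pre (word γ)) (hmap γ),
    fun γ w hw f => ⟨pre w f, hpre w f, ?_⟩, fun γ γ' η => ?_⟩
  · exact hrel (word γ) w f _ _ ((hword γ).trans hw.symm) (hpre _ _) (hpre _ _)
  · induction η using Quotient.inductionOn with
    | h f =>
    refine hrel (word (γ * γ')) (word γ ++ word γ') f _ _ ?_ (hpre _ _) ?_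
    · rw [wordVal_append, hword, hword, hword, incl_mul]
    · rw [hpre, hpre, prepend_append]

end Boundary

end AnosovSemigroup

end

theorem lemma5p8 {Λ : Type*} [Semigroup Λ] {d i : ℕ} (hi : 1 ≤ i) (hid : i < d)
    (ρ : Λ →ₙ* GL (Fin d) ℝ) (hρ : IsAnosov i ρ) (F : Finset Λ) (hF : Generates F) :
    -- the map `E^{cs}`
    ∃ Ecs : QG F → Gr d i,
      (∀ f : QG F, XiTendsto (fun n => ρ (seg f.1 0 n)) (Ecs f)) ∧ Continuous Ecs ∧
    -- the natural action of `Λ` on its boundary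
    ∃ act : Λ → Boundary F → Boundary F, IsNaturalAction act ∧
    -- the boundary map
    ∃ ξ : Boundary F → Gr d i,
      (∀ f : QG F, ξ (endpoint f) = Ecs f) ∧
      Continuous ξ ∧
      (∀ (γ : Λ) (η : Boundary F), ξ (act γ η) = Gr.move (ρ γ) (ξ η)) ∧
      -- `ξ` is dynamics-preserving
      ∀ (γ : Λ) (f : QG F) (φ : ℕ+ → ℕ+) (N : ℕ), StrictMono φ →
        (∀ n : ℕ+, (cayleyGraph F).edist (incl γ ^ (n : ℕ))
          (incl (seg f.1 0 ((φ n : ℕ) - 1))) ≤ N) →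
        IsAttractingFixedPoint (ρ γ) (ξ (endpoint f)) := by
  obtain ⟨L, A, c, hb⟩ := hρ.exists_gapBounds hid hF
  have hlim : ∀ f : QG F, ∃ V : Gr d i,
      Tendsto (fun n => xiGr hid (ρ (seg f.1 0 n))) atTop (𝓝 V) := by
    intro f
    obtain ⟨κ, κ', hκ, _, _, hf⟩ := f.2
    obtain ⟨C, θ, _, _, h⟩ := hb.exists_tendsto_xiGr_seg hi hid hκ κ'
    obtain ⟨V, hV, _⟩ := h f.1 hf
    exact ⟨V, hV⟩
  choose Ecs hE using hlim
  have hcont : Continuous Ecs := hb.continuous_of_tendsto_xiGr hi hid hE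
  choose pre hpre using hb.exists_prepend hid hF
  obtain ⟨act, hact⟩ := exists_isNaturalAction hF hpre
  refine ⟨Ecs, fun f => hb.xiTendsto_seg hi hid f (hE f), hcont, act, hact,
    Quotient.lift (s := qgSetoid F) Ecs fun f g ⟨N, h, _⟩ =>
      hb.limit_eq_of_staysWithin hi hid h (hE f) (hE g), fun f => rfl,
    continuous_coinduced_dom.2 hcont, fun γ η => ?_, fun γ f φ N hφ h =>
      hb.isAttractingFixedPoint_limit hi hid hφ h (hE f)⟩
  induction η using Quotient.inductionOn with
  | h f =>
  obtain ⟨w, hw⟩ := hF (incl γ)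
  obtain ⟨g, hg, hg'⟩ := hact.act_endpoint γ w hw f
  change Quotient.lift (s := qgSetoid F) Ecs _ (act γ (endpoint f)) = Gr.move (ρ γ) (Ecs f)
  rw [hg']
  exact hb.limit_prepend hi hid hw hg (hE f) (hE g)
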